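/- Setting. Let $T>0$, let $U\subset\mathbb R^m$ and $V\subset\mathbb R^l$ be compact, and consider the control system $$\dot x(t)=g_0(x(t),u(t),v(t))+\sum_{i=1}^m g_i(x(t),u(t))\,\dot u_i(t),\qquad x(0)=\bar x_0\in\mathbb R^n,\quad u(0)=\bar u_0\in U, \tag{E}$$ where $g_0:\mathbb R^n\times U\times V\to\mathbb R^n$ is continuous and $(x,u)\mapsto g_0(x,u,v)$ is locally Lipschitz uniformly in $v\in V$, the maps $g_i:\mathbb R^n\times U\to\mathbb R^n$ are locally Lipschitz, and $|g_0(x,u,v)|,|g_i(x,u)|\le M(1+|(x,u)|)$ for some $M>0$. Assume that $U$ has the Whitney property: there is $C\ge1$ such that any $u_1,u_2\in U$ are joined by an absolutely continuous path in $U$ of variation at most $C|u_1-u_2|$. Definitions. $AC(T)$ is the set of absolutely continuous maps $[0,T]\to U$; $\overline{BV}_{loc}(T)$ is the set of maps $u:[0,T]\to U$ with $\mathrm{Var}_{[0,t]}(u)<+\infty$ for every $t<T$; $L^1(T)=L^1([0,T],V)$. Let $u(0)=\bar u_0$, and consider sequences $(u_k)\subset AC(T)$ with $u_k(0)=\bar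 u_0$, $u_k\to u$ pointwise on $[0,T]$ and $\sup_k\mathrm{Var}_{[0,t]}(u_k)<+\infty$ for every $t\in\,]0,T[$; let $x_k$ be the Carathéodory solution of (E) for $(u_k,v)$. * $x$ is a *$BV_{loc}S$ limit solution on $[0,T[$* associated to $(u,v)$ if for some such sequence $(x_k)$ is equibounded on $[0,t]$ for every $t<T$ and $x_k(t)\to x(t)$ for every $t\in[0,T[$. * $x$ is a *$BV_{loc}S$ limit solution on $[0,T]$* associated to $(u,v)$ if $x$ is bounded on $[0,T]$ and for some such sequence $(x_k)$ is equibounded on $[0,T]$, $x_k(t)\to x(t)$ for every $t\in[0,T]$, and there are a positive decreasing function $\tilde\varepsilon$ on $[0,+\infty[$ with $\lim_{s\to+\infty}\tilde\varepsilon(s)=0$ and strictly increasing diverging sequences $(\tilde s_j)\subset[0,+\infty[$ and $(k_j)\subset\mathbb N$, $k_j\ge j$, such that for every $j$ and every $k>k_j$ $$\exists\,\tau^j_k\in[0,T[:\quad \tau^j_k+\mathrm{Var}_{[0,\tau^j_k]}(u_k)=\tilde s_j,\qquad |(x_k,u_k)(\tau^j_k)-(x_k,u_k)(T)|\le\tilde\varepsilon(j).\tag{cBVl}$$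 Claim. 1. For every $\bar x_0\in\mathbb R^n$ and every $(u,v)\in\overline{BV}_{loc}(T)\times L^1(T)$ with $u(0)=\bar u_0$ there is a map $x:[0,T]\to\mathbb R^n$ that is a $BV_{loc}S$ limit solution on $[0,T[$ associated to $(u,v)$ and that, if it is bounded on $[0,T[$ and $U$ has at least two points, is a $BV_{loc}S$ limit solution on $[0,T]$ associated to $(u,v)$. 2. Every $u\in\overline{BV}_{loc}(T)$ is the pointwise limit on $[0,T]$ of a sequence $(u_k)\subset AC(T)$ with $u_k(0)=u(0)$, with $\sup_k\mathrm{Var}_{[0,t]}(u_k)<+\infty$ for every $t<T$ and, if $U$ has at least two points, satisfying (cBVl) for the controls alone, that is, with $|u_k(\tau^j_k)-u_k(T)|\le\tilde\varepsilon(j)$ in place of the last inequality. -/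

import Mathlib

open Set Filter Topology MeasureTheory
open scoped NNReal ENNReal

/-- Data of the control system
`x' = g₀(x,u,v) + ∑ i, gᵢ(x,u) uᵢ'`, with `x ∈ ℝⁿ`, `u ∈ U ⊆ ℝᵐ`, `v ∈ V ⊆ ℝˡ`.
The values of the fields outside `ℝⁿ × U × V` are irrelevant. -/
structure ImpulsiveSystem (n m l : ℕ) where
  U : Set (EuclideanSpace ℝ (Fin m))
  V : Set (EuclideanSpace ℝ (Fin l))
  g₀ : EuclideanSpace ℝ (Fin n) → EuclideanSpace ℝ (Fin m) → EuclideanSpace ℝ (Fin l) →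
    EuclideanSpace ℝ (Fin n)
  g : Fin m → EuclideanSpace ℝ (Fin n) → EuclideanSpace ℝ (Fin m) → EuclideanSpace ℝ (Fin n)

namespace ImpulsiveSystem

variable {n m l : ℕ}

/-- The standing assumptions on the data: compact control sets, continuity, local Lipschitz
continuity (for `g₀` uniformly in `v`) and sublinear growth. -/
structure StandingAssumptions (𝒮 : ImpulsiveSystem n m l) : Prop where
  isCompact_U : IsCompact 𝒮.U
  isCompact_V : IsCompact 𝒮.V
  continuousOn_g₀ : ContinuousOn
    (fun p : EuclideanSpace ℝ (Fin n) × EuclideanSpace ℝ (Fin m) × EuclideanSpace ℝ (Fin l) =>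
      𝒮.g₀ p.1 p.2.1 p.2.2) (univ ×ˢ (𝒮.U ×ˢ 𝒮.V))
  locallyLipschitz_g₀ : ∀ p ∈ (univ : Set (EuclideanSpace ℝ (Fin n))) ×ˢ 𝒮.U,
    ∃ K : ℝ≥0, ∃ N ∈ 𝓝[univ ×ˢ 𝒮.U] p, ∀ v ∈ 𝒮.V,
      LipschitzOnWith K (fun q => 𝒮.g₀ q.1 q.2 v) N
  locallyLipschitz_g : ∀ i, LocallyLipschitzOn (univ ×ˢ 𝒮.U) (fun q => 𝒮.g i q.1 q.2)
  growth : ∃ M > 0, ∀ x, ∀ w ∈ 𝒮.U, ∀ v ∈ 𝒮.V,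
    ‖𝒮.g₀ x w v‖ ≤ M * (1 + ‖(x, w)‖) ∧ ∀ i, ‖𝒮.g i x w‖ ≤ M * (1 + ‖(x, w)‖)

end ImpulsiveSystem

/-- The Whitney property of a set `U ⊆ ℝᵐ`: any two of its points are joined inside `U` by an
absolutely continuous path whose length is at most a fixed multiple of their distance. -/
def WhitneyProperty {m : ℕ} (U : Set (EuclideanSpace ℝ (Fin m))) : Prop :=
  ∃ C : ℝ, 1 ≤ C ∧ ∀ u₁ ∈ U, ∀ u₂ ∈ U, ∃ γ : ℝ → EuclideanSpace ℝ (Fin m),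
    AbsolutelyContinuousOnInterval γ 0 1 ∧ (∀ s ∈ Icc (0 : ℝ) 1, γ s ∈ U) ∧
    γ 0 = u₁ ∧ γ 1 = u₂ ∧ eVariationOn γ (Icc 0 1) ≤ ENNReal.ofReal (C * ‖u₁ - u₂‖)

/-- Controls `u : [0,T] → U` of bounded variation on `[0,t]` for every `t < T`
(the total variation on `[0,T]` may be infinite). -/
def IsBVlocControl {m : ℕ} (U : Set (EuclideanSpace ℝ (Fin m))) (T : ℝ)
    (u : ℝ → EuclideanSpace ℝ (Fin m)) : Prop :=
  (∀ t ∈ Icc 0 T, u t ∈ U) ∧ ∀ t ∈ Ico 0 T, BoundedVariationOn u (Icc 0 t)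

/-- Absolutely continuous controls `u : [0,T] → U`. -/
def IsACControl {m : ℕ} (U : Set (EuclideanSpace ℝ (Fin m))) (T : ℝ)
    (u : ℝ → EuclideanSpace ℝ (Fin m)) : Prop :=
  (∀ t ∈ Icc 0 T, u t ∈ U) ∧ AbsolutelyContinuousOnInterval u 0 T

/-- (Representatives of) elements of `L¹([0,T], V)`. -/
def IsL1Control {l : ℕ} (V : Set (EuclideanSpace ℝ (Fin l))) (T : ℝ)
    (v : ℝ → EuclideanSpace ℝ (Fin l)) : Prop :=
  IntegrableOn v (Icc 0 T) ∧ ∀ᵐ t ∂(volume.restrict (Icc 0 T)), v t ∈ V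

/-- The functions `u k` have variation on `[0,t]` bounded uniformly in `k`, for each `t < T`. -/
def LocallyEquiboundedVariation {F : Type*} [PseudoEMetricSpace F] (T : ℝ) (u : ℕ → ℝ → F) :
    Prop :=
  ∀ t ∈ Ioo 0 T, ∃ W : ℝ≥0, ∀ k, eVariationOn (u k) (Icc 0 t) ≤ W

/-- The functions `x k` are bounded on `s` uniformly in `k`. -/
def EquiboundedOn {F : Type*} [Norm F] (s : Set ℝ) (x : ℕ → ℝ → F) : Prop :=
  ∃ R : ℝ, ∀ k, ∀ t ∈ s, ‖x k t‖ ≤ R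

/-- The final-time condition on a sequence of curves `z k` on `[0,T]` driven by controls `u k`:
there are a positive decreasing `ε̃ : [0,∞[ → ℝ` vanishing at infinity and strictly increasing
diverging sequences `s̃ j ≥ 0` and `κ j ≥ j` such that, for all `k > κ j`, at some time `τ < T` with
`τ + Var_{[0,τ]}(u k) = s̃ j` the point `z k τ` is within `ε̃ j` of `z k T`. -/
def FinalTimeCondition {m : ℕ} {F : Type*} [NormedAddCommGroup F] (T : ℝ)
    (u : ℕ → ℝ → EuclideanSpace ℝ (Fin m)) (z : ℕ → ℝ → F) : Prop :=
  ∃ (ε : ℝ → ℝ) (s : ℕ → ℝ) (κ : ℕ → ℕ),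
    (∀ r, 0 ≤ r → 0 < ε r) ∧ AntitoneOn ε (Ici 0) ∧ Tendsto ε atTop (𝓝 0) ∧
    (∀ j, 0 ≤ s j) ∧ StrictMono s ∧ Tendsto s atTop atTop ∧
    StrictMono κ ∧ (∀ j, j ≤ κ j) ∧
    ∀ j k, κ j < k → ∃ τ, 0 ≤ τ ∧ τ < T ∧
      ENNReal.ofReal τ + eVariationOn (u k) (Icc 0 τ) = ENNReal.ofReal (s j) ∧
      ‖z k τ - z k T‖ ≤ ε j

namespace ImpulsiveSystem

variable {n m l : ℕ}

/-- `x` is the Carathéodory solution on `[0,T]`, with `x(0) = x₀`, for the absolutely continuous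
control `u` and the ordinary control `v`. -/
def IsCaratheodorySolution (𝒮 : ImpulsiveSystem n m l) (T : ℝ) (x₀ : EuclideanSpace ℝ (Fin n))
    (u : ℝ → EuclideanSpace ℝ (Fin m)) (v : ℝ → EuclideanSpace ℝ (Fin l))
    (x : ℝ → EuclideanSpace ℝ (Fin n)) : Prop :=
  AbsolutelyContinuousOnInterval x 0 T ∧ x 0 = x₀ ∧
  ∀ᵐ t ∂(volume.restrict (Ioo 0 T)), DifferentiableAt ℝ u t ∧
    HasDerivAt x (𝒮.g₀ (x t) (u t) (v t) + ∑ i, (deriv u t) i • 𝒮.g i (x t) (u t)) t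

/-- The approximating trajectories of a limit solution: absolutely continuous controls `uk k`, with
`uk k 0 = u 0`, converging to `u` at every point of `[0,T]`, with variation locally equibounded on
`[0,T[`, together with the Carathéodory solutions `xk k` for `(uk k, v)`. -/
def IsApproximation (𝒮 : ImpulsiveSystem n m l) (T : ℝ) (x₀ : EuclideanSpace ℝ (Fin n))
    (u : ℝ → EuclideanSpace ℝ (Fin m)) (v : ℝ → EuclideanSpace ℝ (Fin l))
    (uk : ℕ → ℝ → EuclideanSpace ℝ (Fin m)) (xk : ℕ → ℝ → EuclideanSpace ℝ (Fin n)) : Prop :=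
  (∀ k, IsACControl 𝒮.U T (uk k) ∧ uk k 0 = u 0) ∧
  (∀ t ∈ Icc 0 T, Tendsto (fun k => uk k t) atTop (𝓝 (u t))) ∧
  LocallyEquiboundedVariation T uk ∧
  ∀ k, 𝒮.IsCaratheodorySolution T x₀ (uk k) v (xk k)

/-- `x` is a BV_loc simple limit solution on `[0,T[` associated to `(u,v)`; only the values of `x`
on `[0,T[` matter, and `x` may be unbounded near `T`. -/
def IsBVlocSLimitSolutionIco (𝒮 : ImpulsiveSystem n m l) (T : ℝ) (x₀ : EuclideanSpace ℝ (Fin n))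
    (u : ℝ → EuclideanSpace ℝ (Fin m)) (v : ℝ → EuclideanSpace ℝ (Fin l))
    (x : ℝ → EuclideanSpace ℝ (Fin n)) : Prop :=
  ∃ (uk : ℕ → ℝ → EuclideanSpace ℝ (Fin m)) (xk : ℕ → ℝ → EuclideanSpace ℝ (Fin n)),
    𝒮.IsApproximation T x₀ u v uk xk ∧
    (∀ t ∈ Ico 0 T, EquiboundedOn (Icc 0 t) xk) ∧
    ∀ t ∈ Ico 0 T, Tendsto (fun k => xk k t) atTop (𝓝 (x t))

/-- `x` is a BV_loc simple limit solution on `[0,T]` associated to `(u,v)`. -/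
def IsBVlocSLimitSolutionIcc (𝒮 : ImpulsiveSystem n m l) (T : ℝ) (x₀ : EuclideanSpace ℝ (Fin n))
    (u : ℝ → EuclideanSpace ℝ (Fin m)) (v : ℝ → EuclideanSpace ℝ (Fin l))
    (x : ℝ → EuclideanSpace ℝ (Fin n)) : Prop :=
  Bornology.IsBounded (x '' Icc 0 T) ∧
  ∃ (uk : ℕ → ℝ → EuclideanSpace ℝ (Fin m)) (xk : ℕ → ℝ → EuclideanSpace ℝ (Fin n)),
    𝒮.IsApproximation T x₀ u v uk xk ∧
    EquiboundedOn (Icc 0 T) xk ∧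
    (∀ t ∈ Icc 0 T, Tendsto (fun k => xk k t) atTop (𝓝 (x t))) ∧
    FinalTimeCondition T uk (fun k t => (xk k t, uk k t))

end ImpulsiveSystem

/-! Approximating controls are built by interpolation: on an increasing family of finite grids, join
the values of `u` at consecutive grid points by Whitney paths. Their length between grid points
below `T` is at most the increment of a monotone function `Ψ` on `[0,T[`, which is essentially a
multiple of the arc length of `u`. Hence the variation is locally equibounded. The grids exhaust the
discontinuities of `Ψ` together with a dense set. At exhausted points the controls eventually equal
`u`, and at a continuity point of `Ψ` two nearby grid points squeeze them. Sublinear growth and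
Grönwall bound the trajectories on each `[0,t]` with `t < T`. A diagonal subsequence converges on
the countable set, and at every other time the same squeezing makes it Cauchy, so a limit exists on
all of `[0,T[`.

The endpoint `T` needs a device, since the variation may blow up there and the trajectories need not
settle. At times `τ j` increasing to `T` the control makes an excursion to `u T`, and then to a
fixed `w`. Each excursion costs at most `3CD` in length, with `D` bounding the diameter of `U`, and
this is charged to `Ψ` through a step function jumping just after each `τ j` (`majorant`,
`exists_isApproxControl`). If `w ≠ u T`, which requires two points in `U`, each excursion also uses
length at least `‖w - u T‖`, so time plus length at the successive excursions diverges.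

Suppose the limit is bounded. Up to a length independent of `τ < T`, every time in `[0,τ]` can be
exchanged for one of finitely many times (`exists_finset_arcLength_sub_le`). The trajectories are
therefore eventually bounded on `[0,τ]` by a constant not depending on `τ`
(`exists_eventually_norm_le`). The limit states at the excursions to `u T` then have a cluster point
`ξ`. Stopping the control for good at a late excursion keeps it at `u T`, and the state drifts from
near `ξ` only by a multiple of the remaining time. So the value at `T` can be taken to be `ξ`, and
the earlier excursions along the cluster subsequence witness the final-time condition
(`exists_isBVlocSLimitSolutionIcc`). The assertion on controls alone is the case of a
zero-dimensional state space. -/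

/-! ### Constant-speed Whitney paths -/

/-- An absolutely continuous curve of finite length can be reparametrized with constant speed. -/
theorem AbsolutelyContinuousOnInterval.exists_lipschitz_reparam {F : Type*} [NormedAddCommGroup F]
    {γ : ℝ → F} (hγ : AbsolutelyContinuousOnInterval γ 0 1) {L : ℝ≥0}
    (hL : eVariationOn γ (Icc 0 1) ≤ L) :
    ∃ δ : ℝ → F, LipschitzOnWith L δ (Icc 0 1) ∧ (∀ s ∈ Icc (0 : ℝ) 1, δ s ∈ γ '' Icc 0 1) ∧
      δ 0 = γ 0 ∧ δ 1 = γ 1 := by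
  have hbv : BoundedVariationOn γ (Icc 0 1) := (lt_of_le_of_lt hL ENNReal.coe_lt_top).ne
  have hloc := hbv.locallyBoundedVariationOn
  have h0 : (0 : ℝ) ∈ Icc (0 : ℝ) 1 := by simp
  have h1 : (1 : ℝ) ∈ Icc (0 : ℝ) 1 := by simp
  set V := variationOnFromTo γ (Icc 0 1) 0 with hV
  have hcont : ContinuousOn γ (Icc 0 1) := by
    have := hγ.continuousOn
    rwa [uIcc_of_le zero_le_one] at this
  -- The one-sided jumps of the variation function are those of `γ`, and `γ` is continuous.
  -- Continuity makes the range of `V` an interval, so that `V 1 * s` always lies in the domain of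
  -- the natural parametrization.
  have hVc : ContinuousOn V (Icc 0 1) := by
    intro b hb
    have hl : ContinuousWithinAt V (Icc 0 1 ∩ Iio b) b := by
      have := variationOnFromTo.tendsto_left h0 hb hloc
        ((hcont b hb).mono inter_subset_left : Tendsto γ (𝓝[Icc 0 1 ∩ Iio b] b) (𝓝 (γ b)))
      rw [dist_self, sub_zero] at this
      exact this
    have hr : ContinuousWithinAt V (Icc 0 1 ∩ Ioi b) b := by
      have := variationOnFromTo.tendsto_right h0 hb hloc
        ((hcont b hb).mono inter_subset_left : Tendsto γ (𝓝[Icc 0 1 ∩ Ioi b] b) (𝓝 (γ b)))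
      rw [dist_self, add_zero] at this
      exact this
    have := (hl.union hr).union (continuousWithinAt_singleton (f := V) (x := b))
    refine this.mono fun y hy => ?_
    rcases lt_trichotomy y b with h | h | h
    · exact Or.inl (Or.inl ⟨hy, h⟩)
    · exact Or.inr h
    · exact Or.inl (Or.inr ⟨hy, h⟩)
  have hV0 : V 0 = 0 := variationOnFromTo.self ..
  have hV1 : V 1 = (eVariationOn γ (Icc 0 1)).toReal := by
    rw [hV, variationOnFromTo.eq_of_le _ _ zero_le_one, inter_self]
  have hV1n : 0 ≤ V 1 := hV1 ▸ ENNReal.toReal_nonneg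
  have hV1L : V 1 ≤ L := by
    rw [hV1]
    exact ENNReal.toReal_le_coe_of_le_coe hL
  have hsurj : Icc 0 (V 1) ⊆ V '' Icc 0 1 := by
    have := intermediate_value_Icc (zero_le_one' ℝ) hVc
    rwa [hV0] at this
  set g := naturalParameterization γ (Icc 0 1) 0 with hg
  have hgV : ∀ t ∈ Icc (0 : ℝ) 1, g (V t) = γ t := fun t ht =>
    edist_eq_zero.1 (edist_naturalParameterization_eq_zero hloc h0 ht)
  have hunit := has_unit_speed_naturalParameterization γ hloc h0
  have hscale : ∀ s ∈ Icc (0 : ℝ) 1, V 1 * s ∈ V '' Icc 0 1 := fun s hs =>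
    hsurj ⟨mul_nonneg hV1n hs.1, mul_le_of_le_one_right hV1n hs.2⟩
  have hlip : ∀ s ∈ Icc (0 : ℝ) 1, ∀ t ∈ Icc (0 : ℝ) 1, s ≤ t →
      edist (g (V 1 * s)) (g (V 1 * t)) ≤ L * edist s t := by
    intro s hs t ht hst
    have hst' : V 1 * s ≤ V 1 * t := mul_le_mul_of_nonneg_left hst hV1n
    have := hunit (hscale s hs) (hscale t ht)
    have h2 := eVariationOn.edist_le g (s := V '' Icc 0 1 ∩ Icc (V 1 * s) (V 1 * t))
      ⟨hscale s hs, le_rfl, hst'⟩ ⟨hscale t ht, hst', le_rfl⟩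
    rw [this] at h2
    refine h2.trans ?_
    rw [NNReal.coe_one, one_mul, ← mul_sub, edist_comm, edist_dist, Real.dist_eq,
      abs_of_nonneg (sub_nonneg.2 hst), ENNReal.ofReal_mul hV1n]
    gcongr
    exact ENNReal.ofReal_le_coe.2 hV1L
  refine ⟨fun s => g (V 1 * s), ?_, ?_, ?_, ?_⟩
  · intro s hs t ht
    rcases le_total s t with h | h
    · exact hlip s hs t ht h
    · rw [edist_comm, edist_comm s t]
      exact hlip t ht s hs h
  · intro s hs
    obtain ⟨t, ht, hts⟩ := hscale s hs
    exact ⟨t, ht, by simp only [← hts, hgV t ht]⟩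
  · simp only [mul_zero]
    rw [← hgV 0 h0, hV0]
  · simp only [mul_one]
    rw [hgV 1 h1]

theorem WhitneyProperty.exists_lipschitz_path {m : ℕ} {U : Set (EuclideanSpace ℝ (Fin m))}
    (hU : WhitneyProperty U) :
    ∃ C : ℝ≥0, 1 ≤ C ∧ ∀ u₁ ∈ U, ∀ u₂ ∈ U, ∃ γ : ℝ → EuclideanSpace ℝ (Fin m),
      LipschitzOnWith (C * nndist u₁ u₂) γ (Icc 0 1) ∧ (∀ s ∈ Icc (0 : ℝ) 1, γ s ∈ U) ∧
      γ 0 = u₁ ∧ γ 1 = u₂ := by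
  obtain ⟨C, hC, h⟩ := hU
  refine ⟨C.toNNReal, by simpa using hC, fun u₁ h₁ u₂ h₂ => ?_⟩
  obtain ⟨γ, hγ, hγU, hγ0, hγ1, hvar⟩ := h u₁ h₁ u₂ h₂
  obtain ⟨δ, hδ, hδU, hδ0, hδ1⟩ := hγ.exists_lipschitz_reparam
    (L := C.toNNReal * nndist u₁ u₂) (by
      refine hvar.trans (le_of_eq ?_)
      rw [← dist_eq_norm, ENNReal.ofReal_mul (by linarith), ENNReal.coe_mul, ← edist_nndist,
        edist_dist]
      rfl)
  refine ⟨δ, hδ, fun s hs => ?_, hδ0.trans hγ0, hδ1.trans hγ1⟩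
  obtain ⟨t, ht, hts⟩ := hδU s hs
  rw [← hts]
  exact hγU t ht

/-! ### Comparison of derivatives and Grönwall inequalities -/

theorem norm_deriv_le_of_eventually_norm_sub_le {E : Type*} [NormedAddCommGroup E]
    [NormedSpace ℝ E] {f : ℝ → E} {g : ℝ → ℝ} {f' : E} {g' t : ℝ} (hf : HasDerivAt f f' t)
    (hg : HasDerivAt g g' t) (h : ∀ᶠ s in 𝓝 t, ‖f s - f t‖ ≤ |g s - g t|) : ‖f'‖ ≤ |g'| := by
  have h1 := (hasDerivAt_iff_tendsto_slope.1 hf).norm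
  have h2 := (hasDerivAt_iff_tendsto_slope.1 hg).abs
  refine le_of_tendsto_of_tendsto h1 h2 ?_
  filter_upwards [h.filter_mono nhdsWithin_le_nhds] with s hs
  rw [slope_def_module, slope_def_field, norm_smul, abs_div, div_eq_inv_mul, norm_inv,
    Real.norm_eq_abs]
  gcongr

theorem norm_deriv_le_of_eventually_norm_sub_le_norm {E F : Type*} [NormedAddCommGroup E]
    [NormedSpace ℝ E] [NormedAddCommGroup F] [NormedSpace ℝ F] {f : ℝ → E} {g : ℝ → F} {f' : E}
    {g' : F} {t : ℝ} (hf : HasDerivAt f f' t) (hg : HasDerivAt g g' t)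
    (h : ∀ᶠ s in 𝓝 t, ‖f s - f t‖ ≤ ‖g s - g t‖) : ‖f'‖ ≤ ‖g'‖ := by
  have h1 := (hasDerivAt_iff_tendsto_slope.1 hf).norm
  have h2 := (hasDerivAt_iff_tendsto_slope.1 hg).norm
  refine le_of_tendsto_of_tendsto h1 h2 ?_
  filter_upwards [h.filter_mono nhdsWithin_le_nhds] with s hs
  rw [slope_def_module, slope_def_module, norm_smul, norm_smul]
  gcongr

section FiniteDimensional

variable {E : Type*} [NormedAddCommGroup E] [NormedSpace ℝ E]

theorem LipschitzOnWith.ae_differentiableAt_Ioo [FiniteDimensional ℝ E] {f : ℝ → E} {K : ℝ≥0}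
    {a b : ℝ} (hf : LipschitzOnWith K f (Icc a b)) :
    ∀ᵐ t ∂(volume.restrict (Ioo a b)), DifferentiableAt ℝ f t := by
  rw [ae_restrict_iff' measurableSet_Ioo]
  filter_upwards [hf.ae_differentiableWithinAt_of_mem_real] with t ht h
  exact (ht (Ioo_subset_Icc_self h)).differentiableAt (Icc_mem_nhds h.1 h.2)

theorem LipschitzOnWith.le_of_ae_deriv_nonneg {f : ℝ → ℝ} {K : ℝ≥0} {a b : ℝ} (hab : a ≤ b)
    (hf : LipschitzOnWith K f (Icc a b))
    (h : ∀ᵐ t ∂(volume.restrict (Ioo a b)), 0 ≤ deriv f t) : f a ≤ f b := by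
  have hac : AbsolutelyContinuousOnInterval f a b :=
    LipschitzOnWith.absolutelyContinuousOnInterval (by rwa [uIcc_of_le hab])
  have h1 := hac.integral_deriv_eq_sub
  have h2 : 0 ≤ ∫ t in a..b, deriv f t := by
    rw [intervalIntegral.integral_of_le hab, integral_Ioc_eq_integral_Ioo]
    exact setIntegral_nonneg_of_ae_restrict h
  linarith

/-- The scalar function `A - ‖f - f a‖` is Lipschitz with nonnegative derivative almost everywhere,
hence has nonnegative increment. -/
theorem LipschitzOnWith.norm_sub_le_of_ae_norm_deriv_le [FiniteDimensional ℝ E] {f : ℝ → E}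
    {A : ℝ → ℝ} {K L : ℝ≥0} {a b : ℝ} (hab : a ≤ b) (hf : LipschitzOnWith K f (Icc a b))
    (hA : LipschitzOnWith L A (Icc a b))
    (h : ∀ᵐ t ∂(volume.restrict (Ioo a b)), ‖deriv f t‖ ≤ deriv A t) :
    ‖f b - f a‖ ≤ A b - A a := by
  have hn : LipschitzOnWith K (fun t => ‖f t - f a‖) (Icc a b) := by
    intro s hs t ht
    refine le_trans ?_ (hf hs ht)
    rw [edist_dist, edist_dist]
    refine ENNReal.ofReal_le_ofReal ?_
    rw [Real.dist_eq, dist_eq_norm]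
    refine (abs_norm_sub_norm_le _ _).trans (le_of_eq ?_)
    congr 1
    abel
  have hd := (hA.sub hn).le_of_ae_deriv_nonneg hab (by
    filter_upwards [h, hf.ae_differentiableAt_Ioo, hn.ae_differentiableAt_Ioo,
      hA.ae_differentiableAt_Ioo] with t h1 h2 h3 h4
    have h5 : ‖deriv (fun t => ‖f t - f a‖) t‖ ≤ ‖deriv f t‖ := by
      refine norm_deriv_le_of_eventually_norm_sub_le_norm h3.hasDerivAt h2.hasDerivAt
        (Eventually.of_forall fun s => ?_)
      refine (abs_norm_sub_norm_le _ _).trans (le_of_eq ?_)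
      congr 1
      abel
    rw [show (fun x => A x - ‖f x - f a‖) = A - fun x => ‖f x - f a‖ from rfl,
      deriv_sub h4 h3]
    have := Real.le_norm_self (deriv (fun t => ‖f t - f a‖) t)
    linarith)
  simp only [sub_self, norm_zero] at hd
  linarith

theorem Real.lipschitzOnWith_log : LipschitzOnWith 1 Real.log (Ici 1) := by
  refine LipschitzOnWith.of_dist_le_mul fun x hx y hy => ?_
  have key : ∀ {x y : ℝ}, 1 ≤ x → x ≤ y → |Real.log y - Real.log x| ≤ y - x := by
    intro x y hx hxy
    have hx0 : 0 < x := by linarith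
    rw [abs_of_nonneg (sub_nonneg.2 (Real.log_le_log hx0 hxy)),
      ← Real.log_div (by linarith) hx0.ne']
    refine (Real.log_le_sub_one_of_pos (div_pos (by linarith) hx0)).trans ?_
    rw [div_sub_one hx0.ne', div_le_iff₀ hx0]
    nlinarith
  rw [NNReal.coe_one, one_mul, Real.dist_eq, Real.dist_eq]
  rcases le_total x y with h | h
  · rw [abs_sub_comm, abs_sub_comm x y, abs_of_nonneg (sub_nonneg.2 h)]
    exact key hx h
  · rw [abs_of_nonneg (sub_nonneg.2 h)]
    exact key hy h

/-- A two-sided Grönwall inequality. -/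
theorem LipschitzOnWith.abs_log_sub_le_of_ae_norm_deriv_le [FiniteDimensional ℝ E] {f : ℝ → E}
    {A : ℝ → ℝ} {K L : ℝ≥0} {a b c : ℝ} (hab : a ≤ b) (hc : 1 ≤ c)
    (hf : LipschitzOnWith K f (Icc a b)) (hA : LipschitzOnWith L A (Icc a b))
    (h : ∀ᵐ t ∂(volume.restrict (Ioo a b)), ‖deriv f t‖ ≤ deriv A t * (c + ‖f t‖)) :
    |Real.log (c + ‖f b‖) - Real.log (c + ‖f a‖)| ≤ A b - A a := by
  have hn : LipschitzOnWith K (fun t => c + ‖f t‖) (Icc a b) := by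
    intro s hs t ht
    refine le_trans ?_ (hf hs ht)
    rw [edist_dist, edist_dist]
    refine ENNReal.ofReal_le_ofReal ?_
    rw [Real.dist_eq, dist_eq_norm, add_sub_add_left_eq_sub]
    exact abs_norm_sub_norm_le _ _
  -- The condition `1 ≤ c` keeps the argument in the range where `log` is 1-Lipschitz. The
  -- hypothesis then says that the derivative of this logarithm is dominated by that of `A`.
  have hlog : LipschitzOnWith (1 * K) (fun t => Real.log (c + ‖f t‖)) (Icc a b) :=
    Real.lipschitzOnWith_log.comp hn fun t _ => by
      have := norm_nonneg (f t)
      simp only [mem_Ici]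
      linarith
  refine hlog.norm_sub_le_of_ae_norm_deriv_le hab hA ?_
  filter_upwards [h, hf.ae_differentiableAt_Ioo, hn.ae_differentiableAt_Ioo] with t h1 h2 h3
  have hpos : 0 < c + ‖f t‖ := by have := norm_nonneg (f t); linarith
  have h5 : ‖deriv (fun t => c + ‖f t‖) t‖ ≤ ‖deriv f t‖ := by
    refine norm_deriv_le_of_eventually_norm_sub_le_norm h3.hasDerivAt h2.hasDerivAt
      (Eventually.of_forall fun s => ?_)
    rw [add_sub_add_left_eq_sub]
    exact abs_norm_sub_norm_le _ _
  rw [(h3.hasDerivAt.log hpos.ne').deriv, norm_div, Real.norm_of_nonneg hpos.le,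
    div_le_iff₀ hpos]
  exact h5.trans h1

theorem LipschitzOnWith.add_norm_le_exp_mul_of_ae_norm_deriv_le [FiniteDimensional ℝ E]
    {f : ℝ → E} {A : ℝ → ℝ} {K L : ℝ≥0} {a b c : ℝ} (hab : a ≤ b) (hc : 1 ≤ c)
    (hf : LipschitzOnWith K f (Icc a b)) (hA : LipschitzOnWith L A (Icc a b))
    (h : ∀ᵐ t ∂(volume.restrict (Ioo a b)), ‖deriv f t‖ ≤ deriv A t * (c + ‖f t‖)) :
    c + ‖f b‖ ≤ Real.exp (A b - A a) * (c + ‖f a‖) ∧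
    c + ‖f a‖ ≤ Real.exp (A b - A a) * (c + ‖f b‖) := by
  have h1 := abs_le.1 (hf.abs_log_sub_le_of_ae_norm_deriv_le hab hc hA h)
  have ha : 0 < c + ‖f a‖ := by have := norm_nonneg (f a); linarith
  have hb : 0 < c + ‖f b‖ := by have := norm_nonneg (f b); linarith
  constructor
  · rw [← Real.log_le_log_iff hb (by positivity), Real.log_mul (Real.exp_ne_zero _) ha.ne',
      Real.log_exp]
    linarith
  · rw [← Real.log_le_log_iff ha (by positivity), Real.log_mul (Real.exp_ne_zero _) hb.ne',
      Real.log_exp]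
    linarith

end FiniteDimensional

/-! ### Arc length -/

/-- Arc length of `u` on `[0,t]`. -/
noncomputable def arcLength {E : Type*} [PseudoEMetricSpace E] (u : ℝ → E) (t : ℝ) : ℝ :=
  (eVariationOn u (Icc 0 t)).toReal

section ArcLength

variable {E : Type*} [NormedAddCommGroup E] {u : ℝ → E} {T : ℝ}

theorem arcLength_zero : arcLength u 0 = 0 := by
  simp [arcLength, eVariationOn.subsingleton]

theorem arcLength_nonneg {t : ℝ} : 0 ≤ arcLength u t := ENNReal.toReal_nonneg

theorem arcLength_add {s t : ℝ} (hu : BoundedVariationOn u (Icc 0 t)) (hs : 0 ≤ s) (hst : s ≤ t) :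
    arcLength u s + (eVariationOn u (Icc s t)).toReal = arcLength u t := by
  have h1 : BoundedVariationOn u (Icc 0 s) := hu.mono (Icc_subset_Icc_right hst)
  have h2 : BoundedVariationOn u (Icc s t) := hu.mono (Icc_subset_Icc_left hs)
  have h := eVariationOn.Icc_add_Icc u (s := univ) hs hst (mem_univ _)
  simp only [univ_inter] at h
  rw [arcLength, arcLength, ← h, ENNReal.toReal_add h1 h2]

theorem ofReal_arcLength {t : ℝ} (hu : BoundedVariationOn u (Icc 0 t)) :
    ENNReal.ofReal (arcLength u t) = eVariationOn u (Icc 0 t) :=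
  ENNReal.ofReal_toReal hu

theorem norm_sub_le_arcLength_sub {s t : ℝ} (hu : BoundedVariationOn u (Icc 0 t)) (hs : 0 ≤ s)
    (hst : s ≤ t) : ‖u t - u s‖ ≤ arcLength u t - arcLength u s := by
  rw [← arcLength_add hu hs hst, add_sub_cancel_left, ← dist_eq_norm]
  exact BoundedVariationOn.dist_le (hu.mono (Icc_subset_Icc_left hs)) ⟨hst, le_rfl⟩ ⟨le_rfl, hst⟩

theorem arcLength_mono {s t : ℝ} (hu : BoundedVariationOn u (Icc 0 t)) (hs : 0 ≤ s)
    (hst : s ≤ t) : arcLength u s ≤ arcLength u t := by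
  rw [← arcLength_add hu hs hst]
  exact le_add_of_nonneg_right ENNReal.toReal_nonneg

theorem LipschitzOnWith.eVariationOn_Icc_le {K : ℝ≥0} {a b : ℝ}
    (hu : LipschitzOnWith K u (Icc a b)) :
    eVariationOn u (Icc a b) ≤ ENNReal.ofReal (K * (b - a)) := by
  have := hu.comp_eVariationOn_le (f := u) (g := id) (s := Icc a b) (fun _ h => h)
  rw [Function.comp_id, eVariationOn_id_Icc] at this
  rwa [ENNReal.ofReal_mul K.coe_nonneg, ENNReal.ofReal_coe_nnreal]

theorem LipschitzOnWith.boundedVariationOn_Icc {K : ℝ≥0} {a b : ℝ}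
    (hu : LipschitzOnWith K u (Icc a b)) : BoundedVariationOn u (Icc a b) :=
  (hu.eVariationOn_Icc_le.trans_lt ENNReal.ofReal_lt_top).ne

theorem LipschitzOnWith.arcLength_sub_le {K : ℝ≥0} (hu : LipschitzOnWith K u (Icc 0 T)) {s t : ℝ}
    (hs : 0 ≤ s) (hst : s ≤ t) (ht : t ≤ T) :
    arcLength u t - arcLength u s ≤ K * (t - s) := by
  have h := hu.mono (Icc_subset_Icc_right ht)
  rw [← arcLength_add h.boundedVariationOn_Icc hs hst, add_sub_cancel_left]
  refine ENNReal.toReal_le_of_le_ofReal (mul_nonneg K.coe_nonneg (sub_nonneg.2 hst)) ?_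
  exact (h.mono (Icc_subset_Icc_left hs)).eVariationOn_Icc_le

theorem LipschitzOnWith.arcLength {K : ℝ≥0} (hu : LipschitzOnWith K u (Icc 0 T)) :
    LipschitzOnWith K (arcLength u) (Icc 0 T) := by
  have key : ∀ {s t : ℝ}, 0 ≤ s → s ≤ t → t ≤ T →
      |_root_.arcLength u t - _root_.arcLength u s| ≤ K * (t - s) := by
    intro s t hs hst ht
    have hb := (hu.mono (Icc_subset_Icc_right ht)).boundedVariationOn_Icc
    rw [abs_of_nonneg (sub_nonneg.2 (arcLength_mono hb hs hst))]
    exact hu.arcLength_sub_le hs hst ht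
  refine LipschitzOnWith.of_dist_le_mul fun s hs t ht => ?_
  rw [Real.dist_eq, Real.dist_eq]
  rcases le_total s t with h | h
  · rw [abs_sub_comm, abs_sub_comm s t, abs_of_nonneg (sub_nonneg.2 h)]
    exact key hs.1 h ht.2
  · rw [abs_of_nonneg (sub_nonneg.2 h)]
    exact key ht.1 h hs.2

theorem norm_deriv_le_deriv_arcLength [NormedSpace ℝ E] (hu : BoundedVariationOn u (Icc 0 T))
    {t : ℝ} (ht : t ∈ Ioo 0 T) (hd : DifferentiableAt ℝ u t)
    (hda : DifferentiableAt ℝ (arcLength u) t) : ‖deriv u t‖ ≤ deriv (arcLength u) t := by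
  have hmono : ∀ {s r : ℝ}, 0 ≤ s → s ≤ r → r ≤ T → arcLength u s ≤ arcLength u r :=
    fun hs hsr hr => arcLength_mono (hu.mono (Icc_subset_Icc_right hr)) hs hsr
  have hnn : 0 ≤ deriv (arcLength u) t := by
    have := hasDerivAt_iff_tendsto_slope.1 hda.hasDerivAt
    refine ge_of_tendsto this ?_
    filter_upwards [nhdsWithin_le_nhds (Ioo_mem_nhds ht.1 ht.2)] with s hs
    rw [slope_def_field]
    rcases le_total s t with h | h
    · exact div_nonneg_of_nonpos (sub_nonpos.2 (hmono hs.1.le h ht.2.le)) (sub_nonpos.2 h)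
    · exact div_nonneg (sub_nonneg.2 (hmono ht.1.le h hs.2.le)) (sub_nonneg.2 h)
  rw [← abs_of_nonneg hnn]
  refine norm_deriv_le_of_eventually_norm_sub_le hd.hasDerivAt hda.hasDerivAt ?_
  filter_upwards [Ioo_mem_nhds ht.1 ht.2] with s hs
  rcases le_total s t with h | h
  · rw [norm_sub_rev, abs_sub_comm]
    exact (norm_sub_le_arcLength_sub (hu.mono (Icc_subset_Icc_right ht.2.le)) hs.1.le h).trans
      (le_abs_self _)
  · exact (norm_sub_le_arcLength_sub (hu.mono (Icc_subset_Icc_right hs.2.le)) ht.1.le h).trans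
      (le_abs_self _)

end ArcLength

/-! ### Carathéodory equations with bounded Lipschitz right-hand side -/

/-- Global existence for a bounded Carathéodory field which is Lipschitz in the state. -/
theorem exists_hasDerivAt_ae_of_lipschitz_of_bounded {E : Type*} [NormedAddCommGroup E]
    [NormedSpace ℝ E] [CompleteSpace E] {f : ℝ → E → E} {a b : ℝ} (hab : a ≤ b) {K B : ℝ≥0}
    (hmeas : ∀ x : ℝ → E, Continuous x → AEStronglyMeasurable (fun t => f t (x t)) volume)
    (hlip : ∀ t x y, ‖f t x - f t y‖ ≤ K * ‖x - y‖) (hbd : ∀ t x, ‖f t x‖ ≤ B) (x₀ : E) :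
    ∃ x : ℝ → E, x a = x₀ ∧ LipschitzWith B x ∧
      ∀ᵐ t ∂(volume.restrict (Ioo a b)), HasDerivAt x (f t (x t)) t := by
  -- Bielecki weight: the fixed-point problem is posed for `x / w`. As the integral of `K * w` is at
  -- most `w / 2`, the Picard map contracts with factor `1 / 2` on the whole interval at once.
  set w : ℝ → ℝ := fun t => Real.exp (2 * K * t) with hw
  have hwc : Continuous w := by fun_prop
  have hwpos : ∀ t, 0 < w t := fun t => Real.exp_pos _
  let ext : C(Icc a b, E) → ℝ → E := fun y t => w t • IccExtend hab y t
  have hext : ∀ y, Continuous (ext y) := fun y => hwc.smul y.continuous.Icc_extend'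
  have hii : ∀ y s t, IntervalIntegrable (fun r => f r (ext y r)) volume s t := by
    intro y s t
    refine (intervalIntegrable_const (c := (B : ℝ))).mono_fun (hmeas _ (hext y)).restrict ?_
    refine Eventually.of_forall fun r => ?_
    rw [Real.norm_of_nonneg B.coe_nonneg]
    exact hbd _ _
  let prim : C(Icc a b, E) → ℝ → E := fun y t => x₀ + ∫ r in a..t, f r (ext y r)
  have hprimlip : ∀ y, LipschitzWith B (prim y) := by
    intro y
    refine LipschitzWith.of_dist_le_mul fun s t => ?_
    rw [dist_eq_norm, add_sub_add_left_eq_sub,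
      intervalIntegral.integral_interval_sub_left (hii y _ _) (hii y _ _), Real.dist_eq]
    exact intervalIntegral.norm_integral_le_of_norm_le_const fun r _ => hbd _ _
  let Φ : C(Icc a b, E) → C(Icc a b, E) := fun y =>
    ⟨fun t => (w t)⁻¹ • prim y t, by
      have h1 := (hprimlip y).continuous
      have h2 : Continuous fun t => (w t)⁻¹ := hwc.inv₀ fun t => (hwpos t).ne'
      exact (h2.smul h1).comp continuous_subtype_val⟩
  have hint : ∀ t, ∫ r in a..t, K * w r = (w t - w a) / 2 := by
    intro t
    have hd : ∀ r ∈ uIcc a t, HasDerivAt (fun r => w r / 2) (K * w r) r := by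
      intro r _
      have := (((hasDerivAt_id r).const_mul (2 * (K : ℝ))).exp).div_const 2
      refine this.congr_deriv ?_
      simp only [id, hw]
      ring
    rw [intervalIntegral.integral_eq_sub_of_hasDerivAt hd
      ((continuous_const.mul hwc).intervalIntegrable _ _)]
    ring
  have hΦ : ContractingWith (1 / 2) Φ := by
    refine ⟨by rw [← NNReal.coe_lt_coe]; norm_num, LipschitzWith.of_dist_le_mul fun y z => ?_⟩
    refine (ContinuousMap.dist_le (by positivity)).2 fun t => ?_
    have ht : a ≤ t := t.2.1
    have h1 : ‖∫ r in a..t, (f r (ext y r) - f r (ext z r))‖ ≤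
        ∫ r in a..t, (K * w r) * dist y z := by
      refine intervalIntegral.norm_integral_le_of_norm_le ht ?_ ?_
      · refine Eventually.of_forall fun r _ => (hlip _ _ _).trans ?_
        rw [← smul_sub, norm_smul, Real.norm_of_nonneg (hwpos r).le, mul_assoc]
        gcongr
        rw [← dist_eq_norm]
        exact ContinuousMap.dist_apply_le_dist _
      · exact ((continuous_const.mul hwc).mul continuous_const).intervalIntegrable _ _
    rw [intervalIntegral.integral_mul_const, hint] at h1
    have h2 : Φ y t - Φ z t = (w t)⁻¹ • ∫ r in a..t, (f r (ext y r) - f r (ext z r)) := by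
      rw [intervalIntegral.integral_sub (hii y _ _) (hii z _ _)]
      simp only [Φ, prim, ContinuousMap.coe_mk, ← smul_sub, add_sub_add_left_eq_sub]
    rw [dist_eq_norm, h2, norm_smul, norm_inv, Real.norm_of_nonneg (hwpos t).le,
      inv_mul_le_iff₀ (hwpos t)]
    refine h1.trans ?_
    have h3 : (w t - w a) / 2 ≤ w t * (1 / 2) := by have := hwpos a; linarith
    calc (w t - w a) / 2 * dist y z ≤ w t * (1 / 2) * dist y z := by gcongr
      _ = w t * (((1 / 2 : ℝ≥0) : ℝ) * dist y z) := by push_cast; ring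
  have : Nonempty C(Icc a b, E) := ⟨ContinuousMap.const _ 0⟩
  set y := ContractingWith.fixedPoint Φ hΦ with hy
  have hfix : Φ y = y := hΦ.fixedPoint_isFixedPt
  have heq : ∀ t ∈ Icc a b, ext y t = prim y t := by
    intro t ht
    have h1 : Φ y ⟨t, ht⟩ = y ⟨t, ht⟩ := by rw [hfix]
    have h2 : y ⟨t, ht⟩ = (w t)⁻¹ • prim y t := h1.symm
    simp only [ext]
    rw [IccExtend_of_mem hab y ht, h2, smul_smul, mul_inv_cancel₀ (hwpos t).ne', one_smul]
  refine ⟨prim y, by simp [prim], hprimlip y, ?_⟩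
  rw [ae_restrict_iff' measurableSet_Ioo]
  filter_upwards [(hii y a b).ae_hasDerivAt_integral] with t ht hmem
  have hmem' : t ∈ Icc a b := Ioo_subset_Icc_self hmem
  rw [← heq t hmem']
  exact (ht (by rwa [uIcc_of_le hab]) a (by simp)).const_add x₀

/-! ### Truncation of the state -/

/-- Truncation of every coordinate to `[-R,R]`. -/
noncomputable def coordClamp {n : ℕ} (R : ℝ) (x : EuclideanSpace ℝ (Fin n)) :
    EuclideanSpace ℝ (Fin n) :=
  WithLp.toLp 2 fun i => max (-R) (min R (x i))

section CoordClamp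

variable {n : ℕ} {R : ℝ}

theorem EuclideanSpace.norm_le_of_abs_le {x y : EuclideanSpace ℝ (Fin n)}
    (h : ∀ i, |x i| ≤ |y i|) : ‖x‖ ≤ ‖y‖ := by
  rw [EuclideanSpace.norm_eq, EuclideanSpace.norm_eq]
  refine Real.sqrt_le_sqrt (Finset.sum_le_sum fun i _ => ?_)
  rw [Real.norm_eq_abs, Real.norm_eq_abs]
  exact pow_le_pow_left₀ (abs_nonneg _) (h i) 2

theorem norm_coordClamp_sub_le (x y : EuclideanSpace ℝ (Fin n)) :
    ‖coordClamp R x - coordClamp R y‖ ≤ ‖x - y‖ := by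
  refine EuclideanSpace.norm_le_of_abs_le fun i => ?_
  simp only [coordClamp, PiLp.sub_apply]
  refine (abs_max_sub_max_le_max _ _ _ _).trans ?_
  rw [sub_self, abs_zero]
  refine max_le (abs_nonneg _) ((abs_min_sub_min_le_max _ _ _ _).trans ?_)
  simp

theorem continuous_coordClamp : Continuous (coordClamp R : EuclideanSpace ℝ (Fin n) → _) :=
  (LipschitzWith.of_dist_le_mul (K := 1) fun x y => by
    rw [NNReal.coe_one, one_mul, dist_eq_norm, dist_eq_norm]
    exact norm_coordClamp_sub_le x y).continuous

theorem coordClamp_of_norm_le {x : EuclideanSpace ℝ (Fin n)} (hx : ‖x‖ ≤ R) :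
    coordClamp R x = x := by
  ext i
  have := abs_le.1 ((PiLp.norm_apply_le x i).trans hx)
  simp [coordClamp, this.1, this.2]

theorem norm_coordClamp_le (hR : 0 ≤ R) (x : EuclideanSpace ℝ (Fin n)) :
    ‖coordClamp R x‖ ≤ ‖x‖ := by
  have h := norm_coordClamp_sub_le (R := R) x 0
  rwa [coordClamp_of_norm_le (x := 0) (by simpa), sub_zero, sub_zero] at h

theorem exists_norm_coordClamp_le (hR : 0 ≤ R) :
    ∃ R' : ℝ, 0 ≤ R' ∧ ∀ x : EuclideanSpace ℝ (Fin n), ‖coordClamp R x‖ ≤ R' := by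
  refine ⟨‖(WithLp.toLp 2 fun _ => R : EuclideanSpace ℝ (Fin n))‖, norm_nonneg _, fun x => ?_⟩
  refine EuclideanSpace.norm_le_of_abs_le fun i => ?_
  simp only [coordClamp, abs_of_nonneg hR]
  rw [abs_le]
  exact ⟨le_max_left _ _, max_le (by linarith) (min_le_left _ _)⟩

end CoordClamp

/-! ### Uniform Lipschitz constants on compact sets -/

/-- A family of maps that is locally Lipschitz uniformly in the parameter is Lipschitz on compact
sets uniformly in the parameter. -/
theorem exists_forall_lipschitzOnWith_of_compact {X Y F : Type*} [PseudoMetricSpace X]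
    [TopologicalSpace Y] [NormedAddCommGroup F] {V : Set Y} {A s : Set X} (hV : IsCompact V)
    (hs : IsCompact s) (hsA : s ⊆ A) {g : X → Y → F} (hg : ∀ p ∈ A, ContinuousOn (g p) V)
    (hl : ∀ p ∈ A, ∃ K : ℝ≥0, ∃ N ∈ 𝓝[A] p, ∀ v ∈ V, LipschitzOnWith K (fun q => g q v) N) :
    ∃ K : ℝ≥0, ∀ v ∈ V, LipschitzOnWith K (fun q => g q v) s := by
  classical
  have : CompactSpace V := isCompact_iff_compactSpace.1 hV
  -- A Lipschitz bound uniform in `v` is a Lipschitz bound for a single map into `C(V, F)` with the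
  -- sup norm, to which the parameter-free statement applies.
  let G : X → C(V, F) := fun p =>
    if hp : p ∈ A then ⟨V.domRestrict (g p), (hg p hp).domRestrict⟩ else 0
  have hG : ∀ p ∈ A, ∀ v : V, G p v = g p v := by
    intro p hp v
    simp only [G, dif_pos hp]
    rfl
  have hloc : LocallyLipschitzOn s G := by
    intro p hp
    obtain ⟨K, N, hN, h⟩ := hl p (hsA hp)
    refine ⟨K, N ∩ s, inter_mem (nhdsWithin_mono _ hsA hN) self_mem_nhdsWithin, ?_⟩
    refine LipschitzOnWith.of_dist_le_mul fun q hq r hr => ?_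
    refine (ContinuousMap.dist_le (by positivity)).2 fun v => ?_
    rw [hG q (hsA hq.2), hG r (hsA hr.2)]
    exact (h v v.2).dist_le_mul q hq.1 r hr.1
  obtain ⟨K, hK⟩ := hloc.exists_lipschitzOnWith_of_compact hs
  refine ⟨K, fun v hv => LipschitzOnWith.of_dist_le_mul fun q hq r hr => ?_⟩
  have h1 := ContinuousMap.dist_apply_le_dist (f := G q) (g := G r) ⟨v, hv⟩
  rw [hG q (hsA hq), hG r (hsA hr)] at h1
  exact h1.trans (hK.dist_le_mul q hq r hr)

/-! ### Growth of the right-hand side and a priori estimates -/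

namespace ImpulsiveSystem

variable {n m l : ℕ} {S : ImpulsiveSystem n m l}

/-- The right-hand side of the control system. -/
noncomputable def field (S : ImpulsiveSystem n m l) (x : EuclideanSpace ℝ (Fin n))
    (w : EuclideanSpace ℝ (Fin m)) (v : EuclideanSpace ℝ (Fin l)) (p : EuclideanSpace ℝ (Fin m)) :
    EuclideanSpace ℝ (Fin n) :=
  S.g₀ x w v + ∑ i, p i • S.g i x w

/-- Lipschitz solutions of the control system on `[a,b]`. -/
structure IsLipschitzSolution (S : ImpulsiveSystem n m l) (a b : ℝ)
    (u : ℝ → EuclideanSpace ℝ (Fin m)) (v : ℝ → EuclideanSpace ℝ (Fin l))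
    (x : ℝ → EuclideanSpace ℝ (Fin n)) : Prop where
  lipschitz : ∃ K, LipschitzOnWith K x (Icc a b)
  hasDerivAt : ∀ᵐ t ∂(volume.restrict (Ioo a b)), DifferentiableAt ℝ u t ∧
    HasDerivAt x (S.field (x t) (u t) (v t) (deriv u t)) t

/-- `N` and `c` bound the growth of the right-hand side. -/
def GrowthBound (S : ImpulsiveSystem n m l) (N c : ℝ) : Prop :=
  0 ≤ N ∧ 1 ≤ c ∧ ∀ x, ∀ w ∈ S.U, ∀ v ∈ S.V, ∀ p,
    ‖S.field x w v p‖ ≤ N * (1 + ‖p‖) * (c + ‖x‖)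

/-- Compactness of `U` absorbs the size of the control value into the constant `c`; each of the `m`
impulsive terms costs one factor `‖p‖`. -/
theorem StandingAssumptions.exists_growthBound (hS : S.StandingAssumptions) :
    ∃ N c, S.GrowthBound N c := by
  obtain ⟨M, hM, hg⟩ := hS.growth
  obtain ⟨r, hr⟩ := hS.isCompact_U.isBounded.exists_norm_le
  refine ⟨M * (m + 1), 1 + max r 0, by positivity, by simp, fun x w hw v hv p => ?_⟩
  have hD : M * (1 + ‖(x, w)‖) ≤ M * (1 + max r 0 + ‖x‖) := by
    refine mul_le_mul_of_nonneg_left ?_ hM.le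
    have : ‖(x, w)‖ ≤ max r 0 + ‖x‖ := by
      rw [Prod.norm_def]
      refine max_le ?_ ?_
      · exact le_add_of_nonneg_left (le_max_right _ _)
      · exact ((hr w hw).trans (le_max_left _ _)).trans (le_add_of_nonneg_right (norm_nonneg _))
    linarith
  set D := M * (1 + max r 0 + ‖x‖) with hDdef
  have hD0 : 0 ≤ D := by positivity
  have h0 := ((hg x w hw v hv).1).trans hD
  have hi : ∀ i, ‖p i • S.g i x w‖ ≤ ‖p‖ * D := fun i => by
    rw [norm_smul]
    exact mul_le_mul (PiLp.norm_apply_le p i) (((hg x w hw v hv).2 i).trans hD) (norm_nonneg _)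
      (norm_nonneg _)
  have hsum : ‖∑ i, p i • S.g i x w‖ ≤ m * (‖p‖ * D) := by
    refine (norm_sum_le_of_le _ fun i _ => hi i).trans ?_
    simp
  have h1 : 0 ≤ (m : ℝ) * D + ‖p‖ * D := by positivity
  calc ‖S.field x w v p‖ ≤ D + m * (‖p‖ * D) := norm_add_le_of_le h0 hsum
    _ ≤ (m + 1) * (1 + ‖p‖) * D := by nlinarith
    _ = M * (m + 1) * (1 + ‖p‖) * (1 + max r 0 + ‖x‖) := by rw [hDdef]; ring

section Estimates

variable {N c T : ℝ} {u : ℝ → EuclideanSpace ℝ (Fin m)} {v : ℝ → EuclideanSpace ℝ (Fin l)}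
  {x : ℝ → EuclideanSpace ℝ (Fin n)}

/-- The function whose increments control those of solutions. -/
noncomputable def gauge (N : ℝ) (u : ℝ → EuclideanSpace ℝ (Fin m)) (t : ℝ) : ℝ :=
  N * (t + arcLength u t)

theorem exists_lipschitzOnWith_gauge {K : ℝ≥0} (N : ℝ) (hu : LipschitzOnWith K u (Icc 0 T)) :
    ∃ L, LipschitzOnWith L (gauge N u) (Icc 0 T) := by
  have h1 : LipschitzOnWith (1 + K) (fun t => t + arcLength u t) (Icc 0 T) :=
    (LipschitzWith.id.lipschitzOnWith).add hu.arcLength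
  exact ⟨_, (lipschitzWith_smul N).comp_lipschitzOnWith h1⟩

theorem norm_le_deriv_gauge {K : ℝ≥0} (hN : 0 ≤ N) (hu : LipschitzOnWith K u (Icc 0 T)) :
    ∀ᵐ t ∂(volume.restrict (Ioo 0 T)), N * (1 + ‖deriv u t‖) ≤ deriv (gauge N u) t := by
  filter_upwards [hu.ae_differentiableAt_Ioo, hu.arcLength.ae_differentiableAt_Ioo,
    ae_restrict_mem measurableSet_Ioo] with t h1 h2 ht
  have h3 : HasDerivAt (gauge N u) (N * (1 + deriv (arcLength u) t)) t :=
    ((hasDerivAt_id t).add h2.hasDerivAt).const_mul N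
  rw [h3.deriv]
  gcongr
  exact norm_deriv_le_deriv_arcLength hu.boundedVariationOn_Icc ht h1 h2

theorem IsLipschitzSolution.mono {a b s t : ℝ} (h : S.IsLipschitzSolution a b u v x) (hs : a ≤ s)
    (ht : t ≤ b) : S.IsLipschitzSolution s t u v x := by
  obtain ⟨K, hK⟩ := h.lipschitz
  exact ⟨⟨K, hK.mono (Icc_subset_Icc hs ht)⟩,
    ae_restrict_of_ae_restrict_of_subset (Ioo_subset_Ioo hs ht) h.hasDerivAt⟩

theorem IsLipschitzSolution.ae_norm_deriv_le {K : ℝ≥0} {s t : ℝ}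
    (h : S.IsLipschitzSolution s t u v x) (hNc : S.GrowthBound N c)
    (hu : LipschitzOnWith K u (Icc 0 T)) (huU : ∀ t ∈ Icc 0 T, u t ∈ S.U)
    (hv : ∀ᵐ t ∂(volume.restrict (Icc 0 T)), v t ∈ S.V) (hs : 0 ≤ s) (ht : t ≤ T) :
    ∀ᵐ r ∂(volume.restrict (Ioo s t)), ‖deriv x r‖ ≤ deriv (gauge N u) r * (c + ‖x r‖) := by
  have hsub : Ioo s t ⊆ Ioo 0 T := Ioo_subset_Ioo hs ht
  filter_upwards [h.hasDerivAt,
    ae_restrict_of_ae_restrict_of_subset hsub (norm_le_deriv_gauge hNc.1 hu),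
    ae_restrict_of_ae_restrict_of_subset (hsub.trans Ioo_subset_Icc_self) hv,
    ae_restrict_mem measurableSet_Ioo] with r h1 h2 h3 h4
  rw [h1.2.deriv]
  refine (hNc.2.2 _ _ (huU r (Ioo_subset_Icc_self (hsub h4))) _ h3 _).trans ?_
  have := hNc.2.1
  gcongr

theorem IsLipschitzSolution.gronwall {K : ℝ≥0} {s t : ℝ}
    (h : S.IsLipschitzSolution s t u v x) (hNc : S.GrowthBound N c)
    (hu : LipschitzOnWith K u (Icc 0 T)) (huU : ∀ t ∈ Icc 0 T, u t ∈ S.U)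
    (hv : ∀ᵐ t ∂(volume.restrict (Icc 0 T)), v t ∈ S.V) (hs : 0 ≤ s) (hst : s ≤ t) (ht : t ≤ T) :
    c + ‖x t‖ ≤ Real.exp (gauge N u t - gauge N u s) * (c + ‖x s‖) ∧
    c + ‖x s‖ ≤ Real.exp (gauge N u t - gauge N u s) * (c + ‖x t‖) := by
  obtain ⟨K', hK'⟩ := h.lipschitz
  obtain ⟨L, hL⟩ := exists_lipschitzOnWith_gauge N hu
  exact hK'.add_norm_le_exp_mul_of_ae_norm_deriv_le hst hNc.2.1
    (hL.mono (Icc_subset_Icc hs ht)) (h.ae_norm_deriv_le hNc hu huU hv hs ht)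

theorem IsLipschitzSolution.norm_sub_le {K : ℝ≥0} {s t R : ℝ}
    (h : S.IsLipschitzSolution s t u v x) (hNc : S.GrowthBound N c)
    (hu : LipschitzOnWith K u (Icc 0 T)) (huU : ∀ t ∈ Icc 0 T, u t ∈ S.U)
    (hv : ∀ᵐ t ∂(volume.restrict (Icc 0 T)), v t ∈ S.V) (hs : 0 ≤ s) (hst : s ≤ t) (ht : t ≤ T)
    (hR : ∀ r ∈ Icc s t, ‖x r‖ ≤ R) :
    ‖x t - x s‖ ≤ (c + R) * (gauge N u t - gauge N u s) := by
  obtain ⟨K', hK'⟩ := h.lipschitz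
  obtain ⟨L, hL⟩ := exists_lipschitzOnWith_gauge N hu
  have hL' := hL.mono (Icc_subset_Icc hs ht)
  have hlip : LipschitzOnWith (‖c + R‖₊ * L) (fun r => (c + R) * gauge N u r) (Icc s t) :=
    (lipschitzWith_smul (c + R)).comp_lipschitzOnWith hL'
  rw [mul_sub]
  refine hK'.norm_sub_le_of_ae_norm_deriv_le hst hlip ?_
  filter_upwards [h.ae_norm_deriv_le hNc hu huU hv hs ht, hL'.ae_differentiableAt_Ioo,
    ae_restrict_of_ae_restrict_of_subset (Ioo_subset_Ioo hs ht) (norm_le_deriv_gauge hNc.1 hu),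
    ae_restrict_mem measurableSet_Ioo] with r h1 h2 h3 h4
  rw [(h2.hasDerivAt.const_mul (c + R)).deriv, mul_comm]
  have := hNc.1
  have h5 : 0 ≤ deriv (gauge N u) r := le_trans (by positivity) h3
  refine h1.trans ?_
  have := hR r (Ioo_subset_Icc_self h4)
  gcongr

end Estimates

end ImpulsiveSystem

/-! ### Gluing, and existence of Lipschitz solutions -/

theorem LipschitzOnWith.comp_projIcc {F : Type*} [PseudoEMetricSpace F] {u : ℝ → F} {K : ℝ≥0}
    {a b : ℝ} (hab : a ≤ b) (hu : LipschitzOnWith K u (Icc a b)) :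
    LipschitzWith K fun t => u (projIcc a b hab t) := by
  intro s t
  refine (hu (projIcc a b hab s).2 (projIcc a b hab t).2).trans ?_
  gcongr
  have h := LipschitzWith.projIcc hab s t
  rwa [ENNReal.coe_one, one_mul] at h

theorem LipschitzOnWith.Icc_union {F : Type*} [PseudoMetricSpace F] {f : ℝ → F} {K : ℝ≥0}
    {a b d : ℝ} (h₁ : LipschitzOnWith K f (Icc a b)) (h₂ : LipschitzOnWith K f (Icc b d)) :
    LipschitzOnWith K f (Icc a d) := by
  have key : ∀ s ∈ Icc a d, ∀ t ∈ Icc a d, s ≤ t → dist (f s) (f t) ≤ K * dist s t := by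
    intro s hs t ht hst
    rcases le_total t b with htb | htb
    · exact h₁.dist_le_mul s ⟨hs.1, hst.trans htb⟩ t ⟨ht.1, htb⟩
    rcases le_total b s with hbs | hbs
    · exact h₂.dist_le_mul s ⟨hbs, hs.2⟩ t ⟨htb, ht.2⟩
    have h3 := h₁.dist_le_mul s ⟨hs.1, hbs⟩ b ⟨hs.1.trans hbs, le_rfl⟩
    have h4 := h₂.dist_le_mul b ⟨le_rfl, htb.trans ht.2⟩ t ⟨htb, ht.2⟩
    have h5 : dist s t = dist s b + dist b t := by
      rw [dist_comm s t, dist_comm s b, dist_comm b t, Real.dist_eq, Real.dist_eq, Real.dist_eq,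
        abs_of_nonneg, abs_of_nonneg, abs_of_nonneg] <;> linarith
    rw [h5, mul_add]
    exact (dist_triangle _ _ _).trans (add_le_add h3 h4)
  refine LipschitzOnWith.of_dist_le_mul fun s hs t ht => ?_
  rcases le_total s t with h | h
  · exact key s hs t ht h
  · rw [dist_comm, dist_comm s t]
    exact key t ht s hs h

theorem LipschitzOnWith.congr_eqOn {X F : Type*} [PseudoEMetricSpace X] [PseudoEMetricSpace F]
    {f g : X → F} {K : ℝ≥0} {s : Set X} (hf : LipschitzOnWith K f s) (h : EqOn f g s) :
    LipschitzOnWith K g s := fun x hx y hy => by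
  rw [← h hx, ← h hy]
  exact hf hx hy

namespace ImpulsiveSystem

variable {n m l : ℕ} {S : ImpulsiveSystem n m l}

theorem StandingAssumptions.exists_lipschitz_field (hS : S.StandingAssumptions) (R : ℝ) (P : ℝ≥0) :
    ∃ K : ℝ≥0, ∀ w ∈ S.U, ∀ v ∈ S.V, ∀ p, ‖p‖ ≤ P → ∀ x y, ‖x‖ ≤ R → ‖y‖ ≤ R →
      ‖S.field x w v p - S.field y w v p‖ ≤ K * ‖x - y‖ := by
  have hcomp : IsCompact (Metric.closedBall (0 : EuclideanSpace ℝ (Fin n)) R ×ˢ S.U) :=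
    (isCompact_closedBall _ _).prod hS.isCompact_U
  have hsub : Metric.closedBall (0 : EuclideanSpace ℝ (Fin n)) R ×ˢ S.U ⊆ univ ×ˢ S.U :=
    prod_mono_left (subset_univ _)
  obtain ⟨K₀, hK₀⟩ := exists_forall_lipschitzOnWith_of_compact
    (g := fun q v => S.g₀ q.1 q.2 v) hS.isCompact_V hcomp hsub
    (fun q hq => hS.continuousOn_g₀.comp (f := fun v => (q.1, q.2, v)) (by fun_prop)
      fun v hv => ⟨mem_univ _, hq.2, hv⟩) hS.locallyLipschitz_g₀
  have hKi : ∀ i, ∃ K, LipschitzOnWith K (fun q => S.g i q.1 q.2)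
      (Metric.closedBall (0 : EuclideanSpace ℝ (Fin n)) R ×ˢ S.U) := fun i =>
    ((hS.locallyLipschitz_g i).mono hsub).exists_lipschitzOnWith_of_compact hcomp
  choose K hK using hKi
  have hdist : ∀ (x y : EuclideanSpace ℝ (Fin n)) (w : EuclideanSpace ℝ (Fin m)),
      dist (x, w) (y, w) = ‖x - y‖ := fun x y w => by
    rw [Prod.dist_eq, dist_self, dist_eq_norm, max_eq_left (norm_nonneg _)]
  refine ⟨K₀ + ∑ i, P * K i, fun w hw v hv p hp x y hx hy => ?_⟩
  have hxw : (x, w) ∈ Metric.closedBall (0 : EuclideanSpace ℝ (Fin n)) R ×ˢ S.U :=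
    ⟨by simpa using hx, hw⟩
  have hyw : (y, w) ∈ Metric.closedBall (0 : EuclideanSpace ℝ (Fin n)) R ×ˢ S.U :=
    ⟨by simpa using hy, hw⟩
  have h0 : ‖S.g₀ x w v - S.g₀ y w v‖ ≤ K₀ * ‖x - y‖ := by
    have := (hK₀ v hv).dist_le_mul _ hxw _ hyw
    rwa [hdist, dist_eq_norm] at this
  have hi : ∀ i, ‖p i • S.g i x w - p i • S.g i y w‖ ≤ P * K i * ‖x - y‖ := fun i => by
    have := (hK i).dist_le_mul _ hxw _ hyw
    rw [hdist, dist_eq_norm] at this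
    rw [← smul_sub, norm_smul, mul_assoc]
    exact mul_le_mul ((PiLp.norm_apply_le p i).trans hp) this (norm_nonneg _) P.coe_nonneg
  rw [field, field, add_sub_add_comm, ← Finset.sum_sub_distrib]
  refine (norm_add_le_of_le h0 (norm_sum_le_of_le _ fun i _ => hi i)).trans (le_of_eq ?_)
  push_cast
  rw [add_mul, Finset.sum_mul]

theorem StandingAssumptions.measurable_field (hS : S.StandingAssumptions)
    {x : ℝ → EuclideanSpace ℝ (Fin n)} {u : ℝ → EuclideanSpace ℝ (Fin m)}
    {v : ℝ → EuclideanSpace ℝ (Fin l)} {p : ℝ → EuclideanSpace ℝ (Fin m)} (hx : Measurable x)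
    (hu : Measurable u) (huU : ∀ t, u t ∈ S.U) (hv : Measurable v) (hvV : ∀ t, v t ∈ S.V)
    (hp : Measurable p) : Measurable fun t => S.field (x t) (u t) (v t) (p t) := by
  have h0 : Measurable fun t => S.g₀ (x t) (u t) (v t) :=
    hS.continuousOn_g₀.domRestrict.measurable.comp
      (Measurable.subtype_mk (h := fun t => ⟨mem_univ _, huU t, hvV t⟩)
        (hx.prodMk (hu.prodMk hv)))
  have hi : ∀ i, Measurable fun t => S.g i (x t) (u t) := fun i =>
    (hS.locallyLipschitz_g i).continuousOn.domRestrict.measurable.comp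
      (Measurable.subtype_mk (h := fun t => ⟨mem_univ _, huU t⟩) (hx.prodMk hu))
  refine h0.add (Finset.measurable_sum _ fun i _ => ?_)
  exact Measurable.smul (f := fun t => p t i)
    ((EuclideanSpace.proj (𝕜 := ℝ) i).continuous.measurable.comp hp) (hi i)

/-- The field is only controlled over `V`, whereas the existence result for bounded fields wants
estimates at every time. Changing `v` on a null set, with one fixed value in `V` as default,
provides them. -/
theorem IsL1Control.exists_measurable_rep {V : Set (EuclideanSpace ℝ (Fin l))} (hV : IsCompact V)
    {T : ℝ} (hT : 0 < T) {v : ℝ → EuclideanSpace ℝ (Fin l)} (hv : IsL1Control V T v) :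
    ∃ v' : ℝ → EuclideanSpace ℝ (Fin l), Measurable v' ∧ (∀ t, v' t ∈ V) ∧
      v =ᵐ[volume.restrict (Icc 0 T)] v' := by
  classical
  have : NeZero (volume.restrict (Icc 0 T)) := ⟨by
    rw [Ne, Measure.restrict_eq_zero, Real.volume_Icc]
    simpa using hT⟩
  obtain ⟨t₀, ht₀⟩ := hv.2.exists
  have hsm := hv.1.aestronglyMeasurable
  set w := hsm.mk v
  have hw : Measurable w := hsm.stronglyMeasurable_mk.measurable
  refine ⟨fun t => if w t ∈ V then w t else v t₀,
    Measurable.ite (hw hV.isClosed.measurableSet) hw measurable_const, fun t => ?_, ?_⟩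
  · dsimp only
    split_ifs with h
    exacts [h, ht₀]
  · filter_upwards [hsm.ae_eq_mk, hv.2] with t h1 h2
    rw [h1] at h2 ⊢
    exact (if_pos h2).symm

/-- Truncating the state makes the field bounded and globally Lipschitz. Truncation does not
increase norms, so the growth bound survives and Grönwall keeps the solution in the region where the
truncation is the identity. -/
theorem StandingAssumptions.exists_isLipschitzSolution (hS : S.StandingAssumptions) {T : ℝ}
    (hT : 0 < T) {u : ℝ → EuclideanSpace ℝ (Fin m)} {K : ℝ≥0}
    (hu : LipschitzOnWith K u (Icc 0 T)) (huU : ∀ t ∈ Icc 0 T, u t ∈ S.U)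
    {v : ℝ → EuclideanSpace ℝ (Fin l)} (hv : IsL1Control S.V T v) {a b : ℝ} (ha : 0 ≤ a)
    (hab : a ≤ b) (hb : b ≤ T) (x₀ : EuclideanSpace ℝ (Fin n)) :
    ∃ x, x a = x₀ ∧ S.IsLipschitzSolution a b u v x := by
  obtain ⟨N, c, hNc⟩ := hS.exists_growthBound
  have hN := hNc.1
  have hc := hNc.2.1
  obtain ⟨v', hv'm, hv'V, hvv'⟩ := IsL1Control.exists_measurable_rep hS.isCompact_V hT hv
  set u' : ℝ → EuclideanSpace ℝ (Fin m) := fun t => u (projIcc 0 T hT.le t) with hu'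
  have hu'lip : LipschitzWith K u' := hu.comp_projIcc hT.le
  have hu'U : ∀ t, u' t ∈ S.U := fun t => huU _ (projIcc 0 T hT.le t).2
  have hu'eq : ∀ t ∈ Icc 0 T, u' t = u t := fun t ht => by
    simp only [hu', projIcc_of_mem hT.le ht]
  have hu'd : ∀ t, ‖deriv u' t‖ ≤ K := fun t => norm_deriv_le_of_lipschitz hu'lip
  -- The Grönwall bound itself is the truncation radius, so the solution never leaves the ball where
  -- the two fields agree.
  set R := Real.exp (gauge N u T) * (c + ‖x₀‖) with hR
  have hR0 : 0 ≤ R := by positivity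
  obtain ⟨R', hR'0, hR'⟩ := exists_norm_coordClamp_le (n := n) hR0
  obtain ⟨L, hL⟩ := hS.exists_lipschitz_field R' K
  have hbd : ∀ t x, ‖S.field (coordClamp R x) (u' t) (v' t) (deriv u' t)‖ ≤
      N * (1 + ‖deriv u' t‖) * (c + ‖coordClamp R x‖) := fun t x =>
    hNc.2.2 _ _ (hu'U t) _ (hv'V t) _
  obtain ⟨x, hxa, hxlip, hxd⟩ := exists_hasDerivAt_ae_of_lipschitz_of_bounded
    (f := fun t x => S.field (coordClamp R x) (u' t) (v' t) (deriv u' t)) hab (K := L)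
    (B := (N * (1 + K) * (c + R')).toNNReal)
    (fun x hx => (hS.measurable_field (continuous_coordClamp.comp hx).measurable
      hu'lip.continuous.measurable hu'U hv'm hv'V (measurable_deriv u')).aestronglyMeasurable)
    (fun t x y => (hL _ (hu'U t) _ (hv'V t) _ (hu'd t) _ _ (hR' x) (hR' y)).trans (by
      gcongr
      exact norm_coordClamp_sub_le x y))
    (fun t x => by
      rw [Real.coe_toNNReal _ (by positivity)]
      refine (hbd t x).trans ?_
      have := hu'd t
      have := hR' x
      gcongr) x₀
  have hsub : Ioo a b ⊆ Ioo 0 T := Ioo_subset_Ioo ha hb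
  have hu'ev : ∀ t ∈ Ioo 0 T, u' =ᶠ[𝓝 t] u := fun t ht => by
    filter_upwards [Ioo_mem_nhds ht.1 ht.2] with r hr
    exact hu'eq r (Ioo_subset_Icc_self hr)
  obtain ⟨Lg, hLg⟩ := exists_lipschitzOnWith_gauge N hu
  have hle : ∀ t ∈ Icc a b, ‖x t‖ ≤ R := by
    intro t ht
    have hsub' : Ioo a t ⊆ Ioo a b := Ioo_subset_Ioo_right ht.2
    have h := ((hxlip.lipschitzOnWith (s := Icc a t)).add_norm_le_exp_mul_of_ae_norm_deriv_le ht.1 hc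
      (hLg.mono (Icc_subset_Icc ha (ht.2.trans hb))) (by
        filter_upwards [ae_restrict_of_ae_restrict_of_subset hsub' hxd,
          ae_restrict_of_ae_restrict_of_subset (hsub'.trans hsub) (norm_le_deriv_gauge hN hu),
          ae_restrict_mem measurableSet_Ioo] with r h1 h2 h3
        rw [h1.deriv]
        refine (hbd r _).trans ?_
        rw [(hu'ev r (hsub (hsub' h3))).deriv_eq]
        have h4 := norm_coordClamp_le hR0 (x r)
        have h5 : 0 ≤ deriv (gauge N u) r := le_trans (by positivity) h2
        gcongr)).1
    rw [hxa] at h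
    have hga : 0 ≤ gauge N u a :=
      mul_nonneg hN (add_nonneg ha arcLength_nonneg)
    have hgt : gauge N u t ≤ gauge N u T := by
      have := arcLength_mono hu.boundedVariationOn_Icc (ha.trans ht.1) (ht.2.trans hb)
      have := ht.2.trans hb
      simp only [gauge]
      gcongr
    calc ‖x t‖ ≤ c + ‖x t‖ := by linarith
      _ ≤ _ := h
      _ ≤ R := by
        rw [hR]
        gcongr
        linarith
  refine ⟨x, hxa, ⟨_, hxlip.lipschitzOnWith⟩, ?_⟩
  filter_upwards [hxd, ae_restrict_mem measurableSet_Ioo,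
    ae_restrict_of_ae_restrict_of_subset hsub hu.ae_differentiableAt_Ioo,
    ae_restrict_of_ae_restrict_of_subset (hsub.trans Ioo_subset_Icc_self) hvv'] with t h1 h2 h3 h4
  refine ⟨h3, ?_⟩
  rwa [coordClamp_of_norm_le (hle t (Ioo_subset_Icc_self h2)), hu'eq t (Ioo_subset_Icc_self (hsub h2)),
    (hu'ev t (hsub h2)).deriv_eq, ← h4] at h1

/-- Gluing a solution on `[a,b]` with one on `[b,d]`. -/
theorem IsLipschitzSolution.glue {a b d : ℝ} {u : ℝ → EuclideanSpace ℝ (Fin m)}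
    {v : ℝ → EuclideanSpace ℝ (Fin l)} {x y : ℝ → EuclideanSpace ℝ (Fin n)}
    (hx : S.IsLipschitzSolution a b u v x) (hy : S.IsLipschitzSolution b d u v y)
    (hxy : x b = y b) :
    S.IsLipschitzSolution a d u v (fun t => if t ≤ b then x t else y t) := by
  set z : ℝ → EuclideanSpace ℝ (Fin n) := fun t => if t ≤ b then x t else y t with hz
  have hzx : ∀ t ≤ b, z t = x t := fun t ht => if_pos ht
  have hzy : ∀ t, b ≤ t → z t = y t := fun t ht => by
    rcases ht.eq_or_lt with rfl | ht
    · rw [hzx _ le_rfl, hxy]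
    · exact if_neg ht.not_ge
  obtain ⟨K₁, hK₁⟩ := hx.lipschitz
  obtain ⟨K₂, hK₂⟩ := hy.lipschitz
  refine ⟨⟨max K₁ K₂, LipschitzOnWith.Icc_union (b := b) ?_ ?_⟩, ?_⟩
  · exact (hK₁.weaken (le_max_left _ _)).congr_eqOn fun t ht => (hzx t ht.2).symm
  · exact (hK₂.weaken (le_max_right _ _)).congr_eqOn fun t ht => (hzy t ht.1).symm
  · have h1 := (ae_restrict_iff' measurableSet_Ioo).1 hx.hasDerivAt
    have h2 := (ae_restrict_iff' measurableSet_Ioo).1 hy.hasDerivAt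
    have h3 : ∀ᵐ t : ℝ, t ≠ b := by simp [ae_iff, measure_singleton]
    rw [ae_restrict_iff' measurableSet_Ioo]
    filter_upwards [h1, h2, h3] with t h1 h2 h3 ht
    rcases lt_or_gt_of_ne h3 with h | h
    · obtain ⟨h4, h5⟩ := h1 ⟨ht.1, h⟩
      rw [hzx t h.le]
      refine ⟨h4, h5.congr_of_eventuallyEq ?_⟩
      filter_upwards [Iio_mem_nhds h] with r hr using hzx r (le_of_lt hr)
    · obtain ⟨h4, h5⟩ := h2 ⟨h, ht.2⟩
      rw [hzy t h.le]
      refine ⟨h4, h5.congr_of_eventuallyEq ?_⟩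
      filter_upwards [Ioi_mem_nhds h] with r hr using hzy r (le_of_lt hr)

theorem IsLipschitzSolution.congr_control {a b : ℝ} {u u' : ℝ → EuclideanSpace ℝ (Fin m)}
    {v : ℝ → EuclideanSpace ℝ (Fin l)} {x : ℝ → EuclideanSpace ℝ (Fin n)}
    (hx : S.IsLipschitzSolution a b u v x) (h : EqOn u u' (Ioo a b)) :
    S.IsLipschitzSolution a b u' v x := by
  refine ⟨hx.lipschitz, ?_⟩
  filter_upwards [hx.hasDerivAt, ae_restrict_mem measurableSet_Ioo] with t h1 ht
  have hev : u =ᶠ[𝓝 t] u' := h.eventuallyEq_of_mem (Ioo_mem_nhds ht.1 ht.2)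
  rw [← h ht, ← hev.deriv_eq]
  exact ⟨hev.differentiableAt_iff.1 h1.1, h1.2⟩

theorem IsLipschitzSolution.isCaratheodorySolution {T : ℝ} (hT : 0 ≤ T)
    {u : ℝ → EuclideanSpace ℝ (Fin m)} {v : ℝ → EuclideanSpace ℝ (Fin l)}
    {x : ℝ → EuclideanSpace ℝ (Fin n)} (hx : S.IsLipschitzSolution 0 T u v x) :
    S.IsCaratheodorySolution T (x 0) u v x := by
  obtain ⟨K, hK⟩ := hx.lipschitz
  exact ⟨LipschitzOnWith.absolutelyContinuousOnInterval (by rwa [uIcc_of_le hT]), rfl,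
    hx.hasDerivAt⟩

end ImpulsiveSystem

/-! ### Interpolation by Lipschitz paths on finite grids -/

/-- Lipschitz paths in `U` on an interval. -/
structure IsLipschitzPath {F : Type*} [PseudoMetricSpace F] (U : Set F) (p q : ℝ) (δ : ℝ → F) :
    Prop where
  lipschitz : ∃ K, LipschitzOnWith K δ (Icc p q)
  mem : ∀ t ∈ Icc p q, δ t ∈ U

namespace IsLipschitzPath

variable {F : Type*} [NormedAddCommGroup F] {U : Set F}

theorem congr {p q : ℝ} {δ δ' : ℝ → F} (h : IsLipschitzPath U p q δ) (he : EqOn δ δ' (Icc p q)) :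
    IsLipschitzPath U p q δ' := by
  obtain ⟨K, hK⟩ := h.lipschitz
  exact ⟨⟨K, hK.congr_eqOn he⟩, fun t ht => he ht ▸ h.mem t ht⟩

theorem union {p r q : ℝ} {δ : ℝ → F} (h₁ : IsLipschitzPath U p r δ)
    (h₂ : IsLipschitzPath U r q δ) : IsLipschitzPath U p q δ := by
  obtain ⟨K₁, hK₁⟩ := h₁.lipschitz
  obtain ⟨K₂, hK₂⟩ := h₂.lipschitz
  refine ⟨⟨max K₁ K₂, (hK₁.weaken (le_max_left _ _)).Icc_union (hK₂.weaken (le_max_right _ _))⟩,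
    fun t ht => ?_⟩
  rcases le_total t r with h | h
  exacts [h₁.mem t ⟨ht.1, h⟩, h₂.mem t ⟨h, ht.2⟩]

theorem exists_glue {p r q : ℝ} {δ₁ δ₂ : ℝ → F} (h₁ : IsLipschitzPath U p r δ₁)
    (h₂ : IsLipschitzPath U r q δ₂) (h : δ₁ r = δ₂ r) :
    ∃ δ, IsLipschitzPath U p q δ ∧ EqOn δ δ₁ (Iic r) ∧ EqOn δ δ₂ (Ici r) := by
  set δ : ℝ → F := fun t => if t ≤ r then δ₁ t else δ₂ t
  have e₁ : EqOn δ δ₁ (Iic r) := fun t ht => if_pos ht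
  have e₂ : EqOn δ δ₂ (Ici r) := fun t ht => by
    rcases (show r ≤ t from ht).eq_or_lt with rfl | ht
    · rw [e₁ (mem_Iic.2 le_rfl), h]
    · exact if_neg ht.not_ge
  exact ⟨δ, (h₁.congr fun t ht => (e₁ ht.2).symm).union (h₂.congr fun t ht => (e₂ ht.1).symm),
    e₁, e₂⟩

end IsLipschitzPath

section Interpolation

variable {F : Type*} [NormedAddCommGroup F] {U : Set F}

/-- `p < q` are consecutive elements of `P`. -/
def Consecutive (P : Finset ℝ) (p q : ℝ) : Prop :=
  p ∈ P ∧ q ∈ P ∧ p < q ∧ ∀ r ∈ P, r ≤ p ∨ q ≤ r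

theorem exists_consecutive {P : Finset ℝ} {a b s : ℝ} (ha : a ∈ P) (hb : b ∈ P) (has : a ≤ s)
    (hsb : s < b) : ∃ p q, Consecutive P p q ∧ p ≤ s ∧ s < q := by
  have h₁ : (P.filter (· ≤ s)).Nonempty := ⟨a, by simp [ha, has]⟩
  have h₂ : (P.filter (s < ·)).Nonempty := ⟨b, by simp [hb, hsb]⟩
  have hp := Finset.mem_filter.1 (Finset.max'_mem _ h₁)
  have hq := Finset.mem_filter.1 (Finset.min'_mem _ h₂)
  refine ⟨_, _, ⟨hp.1, hq.1, hp.2.trans_lt hq.2, fun r hr => ?_⟩, hp.2, hq.2⟩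
  rcases le_or_gt r s with h | h
  · exact Or.inl (Finset.le_max' _ _ (Finset.mem_filter.2 ⟨hr, h⟩))
  · exact Or.inr (Finset.min'_le _ _ (Finset.mem_filter.2 ⟨hr, h⟩))

/-- Joining paths that interpolate `u` between consecutive points of a finite set. -/
theorem exists_interpolation {u : ℝ → F} {a b : ℝ} (hu : ∀ t ∈ Icc a b, u t ∈ U)
    (Q : ℝ → ℝ → (ℝ → F) → Prop)
    (hQ : ∀ p q δ δ', EqOn δ δ' (Icc p q) → Q p q δ → Q p q δ')
    (hstep : ∀ p ∈ Icc a b, ∀ q ∈ Icc a b, p < q →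
      ∃ δ, IsLipschitzPath U p q δ ∧ δ p = u p ∧ δ q = u q ∧ Q p q δ)
    (P : Finset ℝ) (hP : ∀ p ∈ P, p ∈ Icc a b) :
    ∃ z : ℝ → F, (∀ p ∈ P, ∀ q ∈ P, IsLipschitzPath U p q z) ∧ (∀ p ∈ P, z p = u p) ∧
      ∀ p q, Consecutive P p q → Q p q z := by
  induction P using Finset.induction_on_max with
  | empty => exact ⟨u, by simp, by simp, fun p q h => by simp [Consecutive] at h⟩
  | insert c s hs ih =>
    have hsP : ∀ p ∈ s, p ∈ Icc a b := fun p hp => hP p (Finset.mem_insert_of_mem hp)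
    have hc := hP c (Finset.mem_insert_self _ _)
    obtain ⟨z, hz1, hz2, hz3⟩ := ih hsP
    have hcc : ∀ z : ℝ → F, z c ∈ U → IsLipschitzPath U c c z := fun z hz =>
      ⟨⟨0, by
        intro x hx y hy
        rw [Icc_self] at hx hy
        rw [mem_singleton_iff.1 hx, mem_singleton_iff.1 hy]
        simp⟩, fun t ht => by
        rw [Icc_self] at ht
        rwa [mem_singleton_iff.1 ht]⟩
    have hemp : ∀ p < c, ∀ z : ℝ → F, IsLipschitzPath U c p z := fun p hp z => by
      refine ⟨⟨0, ?_⟩, ?_⟩ <;> rw [Icc_eq_empty hp.not_ge] <;> simp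
    rcases s.eq_empty_or_nonempty with rfl | hne
    · refine ⟨u, ?_, by simp, fun p q h => ?_⟩
      · simp only [insert_empty_eq, Finset.mem_singleton, forall_eq]
        exact hcc u (hu c hc)
      · simp only [Consecutive, insert_empty_eq, Finset.mem_singleton] at h
        exact absurd h.2.2.1 (by rw [h.1, h.2.1]; exact lt_irrefl _)
    set r := s.max' hne with hr
    have hrs : r ∈ s := s.max'_mem hne
    have hle : ∀ p ∈ s, p ≤ r := fun p hp => s.le_max' p hp
    obtain ⟨δ, hδ, hδr, hδc, hδQ⟩ := hstep r (hsP r hrs) c hc (hs r hrs)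
    obtain ⟨z', hz', he1, he2⟩ := (hz1 r hrs r hrs).exists_glue hδ
      ((hz2 r hrs).trans hδr.symm)
    have hz'p : ∀ p ∈ s, ∀ q ∈ s, IsLipschitzPath U p q z' := fun p hp q hq =>
      (hz1 p hp q hq).congr fun t ht => (he1 (ht.2.trans (hle q hq))).symm
    have hz'c : z' c = u c := (he2 (hs r hrs).le).trans hδc
    refine ⟨z', ?_, ?_, ?_⟩
    · intro p hp q hq
      rw [Finset.mem_insert] at hp hq
      rcases hp with rfl | hp <;> rcases hq with rfl | hq
      · exact hcc z' (hz'c ▸ hu _ hc)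
      · exact hemp q (hs q hq) z'
      · exact (hz'p p hp r hrs).union hz'
      · exact hz'p p hp q hq
    · intro p hp
      rw [Finset.mem_insert] at hp
      rcases hp with rfl | hp
      · exact hz'c
      · exact (he1 (hle p hp)).trans (hz2 p hp)
    · rintro p q ⟨hp, hq, hpq, hcons⟩
      rw [Finset.mem_insert] at hp hq
      rcases hp with rfl | hp
      · rcases hq with rfl | hq
        · exact absurd hpq (lt_irrefl _)
        · exact absurd hpq (hs q hq).not_gt
      rcases hq with rfl | hq
      · have hpr : p = r := by
          rcases hcons r (Finset.mem_insert_of_mem hrs) with h | h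
          · exact le_antisymm (hle p hp) h
          · exact absurd h (hs r hrs).not_ge
        rw [hpr]
        exact hQ _ _ _ _ (fun t ht => (he2 ht.1).symm) hδQ
      · exact hQ _ _ _ _ (fun t ht => (he1 (ht.2.trans (hle q hq))).symm)
          (hz3 p q ⟨hp, hq, hpq, fun x hx => hcons x (Finset.mem_insert_of_mem hx)⟩)

/-- Variation bounds between consecutive points add up. -/
theorem eVariationOn_Icc_le_of_consecutive {z : ℝ → F} {Ψ : ℝ → ℝ} {P : Finset ℝ} {T : ℝ}
    (hΨ : MonotoneOn Ψ (Ico 0 T)) (hP : ∀ p ∈ P, 0 ≤ p)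
    (h : ∀ p q, Consecutive P p q → q < T → eVariationOn z (Icc p q) ≤ ENNReal.ofReal (Ψ q - Ψ p))
    {p q : ℝ} (hp : p ∈ P) (hq : q ∈ P) (hpq : p ≤ q) (hqT : q < T) :
    eVariationOn z (Icc p q) ≤ ENNReal.ofReal (Ψ q - Ψ p) := by
  -- Induction on the number of grid points before `q`: split off the last step and pass to the
  -- predecessor of `q`.
  induction hn : (P.filter (· < q)).card using Nat.strong_induction_on generalizing q with
  | _ n ih =>
    rcases hpq.eq_or_lt with rfl | hlt
    · simp [eVariationOn.subsingleton]
    have hne : (P.filter (· < q)).Nonempty := ⟨p, by simp [hp, hlt]⟩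
    set r := (P.filter (· < q)).max' hne with hr
    have hrm := Finset.mem_filter.1 ((P.filter (· < q)).max'_mem hne)
    have hpr : p ≤ r := Finset.le_max' _ _ (by simp [hp, hlt])
    have hcons : Consecutive P r q := by
      refine ⟨hrm.1, hq, hrm.2, fun x hx => ?_⟩
      rcases lt_or_ge x q with h | h
      · exact Or.inl (Finset.le_max' _ _ (Finset.mem_filter.2 ⟨hx, h⟩))
      · exact Or.inr h
    have hcard : (P.filter (· < r)).card < n := by
      rw [← hn]
      refine Finset.card_lt_card ⟨fun x hx => ?_, fun hsub => ?_⟩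
      · rw [Finset.mem_filter] at hx ⊢
        exact ⟨hx.1, hx.2.trans hrm.2⟩
      · have := Finset.mem_filter.1 (hsub (Finset.mem_filter.2 hrm))
        exact lt_irrefl _ this.2
    have h1 := ih _ hcard hrm.1 hpr (hrm.2.trans hqT) rfl
    have h2 := h r q hcons hqT
    have h3 := eVariationOn.Icc_add_Icc z (s := univ) hpr hrm.2.le (mem_univ _)
    simp only [univ_inter] at h3
    rw [← h3]
    refine (add_le_add h1 h2).trans (le_of_eq ?_)
    have hm1 : Ψ p ≤ Ψ r := hΨ ⟨hP p hp, hlt.trans hqT⟩ ⟨hP r hrm.1, hrm.2.trans hqT⟩ hpr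
    have hm2 : Ψ r ≤ Ψ q := hΨ ⟨hP r hrm.1, hrm.2.trans hqT⟩ ⟨hP q hq, hqT⟩ hrm.2.le
    rw [← ENNReal.ofReal_add (sub_nonneg.2 hm1) (sub_nonneg.2 hm2)]
    congr 1
    ring

/-- Lipschitz paths on arbitrary intervals, from those on `[0,1]`. -/
theorem exists_isLipschitzPath_of_unitInterval [NormedSpace ℝ F] {C : ℝ≥0}
    (hU : ∀ u₁ ∈ U, ∀ u₂ ∈ U, ∃ γ : ℝ → F, LipschitzOnWith (C * nndist u₁ u₂) γ (Icc 0 1) ∧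
      (∀ s ∈ Icc (0 : ℝ) 1, γ s ∈ U) ∧ γ 0 = u₁ ∧ γ 1 = u₂)
    {u₁ u₂ : F} (h₁ : u₁ ∈ U) (h₂ : u₂ ∈ U) {p q : ℝ} (hpq : p < q) :
    ∃ δ, IsLipschitzPath U p q δ ∧ δ p = u₁ ∧ δ q = u₂ ∧
      eVariationOn δ (Icc p q) ≤ ENNReal.ofReal (C * ‖u₂ - u₁‖) := by
  obtain ⟨γ, hγ, hγU, hγ0, hγ1⟩ := hU u₁ h₁ u₂ h₂
  have hd : 0 < q - p := sub_pos.2 hpq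
  set φ : ℝ → ℝ := fun t => (t - p) / (q - p) with hφ
  have hmaps : ∀ t ∈ Icc p q, φ t ∈ Icc (0 : ℝ) 1 := fun t ht =>
    ⟨div_nonneg (sub_nonneg.2 ht.1) hd.le, (div_le_one hd).2 (by linarith [ht.2])⟩
  have hφlip : LipschitzWith ((q - p)⁻¹).toNNReal φ := by
    refine LipschitzWith.of_dist_le_mul fun s t => ?_
    rw [Real.coe_toNNReal _ (by positivity), Real.dist_eq, Real.dist_eq, hφ, ← sub_div,
      sub_sub_sub_cancel_right, abs_div, abs_of_pos hd, div_eq_inv_mul]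
  have hlip := hγ.comp (hφlip.lipschitzOnWith (s := Icc p q)) hmaps
  refine ⟨γ ∘ φ, ⟨⟨_, hlip⟩, fun t ht => hγU _ (hmaps t ht)⟩, ?_, ?_, ?_⟩
  · simp [hφ, hγ0]
  · simp [hφ, div_self hd.ne', hγ1]
  · refine hlip.eVariationOn_Icc_le.trans (ENNReal.ofReal_le_ofReal (le_of_eq ?_))
    push_cast
    rw [Real.coe_toNNReal _ (inv_nonneg.2 hd.le), dist_comm, dist_eq_norm]
    field_simp

end Interpolation

/-! ### Interpolating controls with excursions -/

/-- Times increasing to `T`, at which excursions are made. -/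
noncomputable def excursionTime (T : ℝ) (j : ℕ) : ℝ := T - T / (j + 2)

/-- A monotone function on `[0,T[` that dominates the length of the approximating controls. -/
noncomputable def majorant {F : Type*} [PseudoEMetricSpace F] (C D T : ℝ) (u : ℝ → F) (t : ℝ) : ℝ :=
  C * arcLength u t + 3 * C * D * ⌈T / (T - t)⌉

/-- Lipschitz controls on `[0,T]` with values in `U` that agree with `u` on `P`, with an excursion
to `u T` and then to `w` after each excursion time in `P`. -/
structure IsApproxControl {F : Type*} [NormedAddCommGroup F] (U : Set F) (T : ℝ) (u : ℝ → F)
    (Ψ : ℝ → ℝ) (B : ℝ) (w : F) (P : Finset ℝ) (z : ℝ → F) : Prop where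
  lipschitz : ∃ K, LipschitzOnWith K z (Icc 0 T)
  mem : ∀ t ∈ Icc 0 T, z t ∈ U
  eq_of_mem : ∀ p ∈ P, z p = u p
  exists_step : ∀ s ∈ Ico 0 T, ∃ p ∈ P, ∃ q ∈ P, 0 ≤ p ∧ p ≤ s ∧ s < q ∧ q ≤ T ∧
    arcLength z q - arcLength z p ≤ B
  arcLength_sub_le : ∀ p ∈ P, ∀ q ∈ P, p ≤ q → q < T → arcLength z q - arcLength z p ≤ Ψ q - Ψ p
  excursion : ∀ j, excursionTime T j ∈ P → ∃ θ θ', excursionTime T j < θ ∧ θ < θ' ∧ θ' < T ∧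
    (∀ p ∈ P, p ≤ excursionTime T j ∨ θ' ≤ p) ∧ z θ = u T ∧ z θ' = w

section ExcursionTime

variable {T : ℝ}

theorem excursionTime_mem_Ioo (hT : 0 < T) (j : ℕ) : excursionTime T j ∈ Ioo 0 T := by
  have h : T / (j + 2) < T := div_lt_self hT (by have : (0 : ℝ) ≤ j := j.cast_nonneg; linarith)
  have h' : 0 < T / (j + 2) := by positivity
  exact ⟨sub_pos.2 h, sub_lt_self _ h'⟩

theorem div_sub_excursionTime (hT : 0 < T) (j : ℕ) : T / (T - excursionTime T j) = j + 2 := by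
  rw [excursionTime, sub_sub_cancel]
  field_simp

theorem monotoneOn_div_sub (hT : 0 < T) : MonotoneOn (fun t => T / (T - t)) (Ico 0 T) := by
  intro s hs t ht hst
  have : 0 < T - t := sub_pos.2 ht.2
  dsimp only
  gcongr

theorem strictMonoOn_div_sub (hT : 0 < T) : StrictMonoOn (fun t => T / (T - t)) (Ico 0 T) := by
  intro s hs t ht hst
  have : 0 < T - t := sub_pos.2 ht.2
  dsimp only
  gcongr

theorem strictMono_excursionTime (hT : 0 < T) : StrictMono (excursionTime T) := by
  intro i j hij
  simp only [excursionTime]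
  gcongr

theorem tendsto_excursionTime (T : ℝ) : Tendsto (excursionTime T) atTop (𝓝 T) := by
  have h : Tendsto (fun j : ℕ => T / ((j : ℝ) + 2)) atTop (𝓝 0) :=
    tendsto_const_nhds.div_atTop (tendsto_atTop_add_const_right _ _ tendsto_natCast_atTop_atTop)
  have h' := (tendsto_const_nhds (x := T)).sub h
  rw [sub_zero] at h'
  exact h'

end ExcursionTime

section Existence

variable {F : Type*} [NormedAddCommGroup F] {U : Set F} {u : ℝ → F} {T : ℝ}

theorem monotoneOn_majorant {C D : ℝ} (hC : 0 ≤ C) (hD : 0 ≤ D) (hT : 0 < T)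
    (hbv : ∀ t ∈ Ico 0 T, BoundedVariationOn u (Icc 0 t)) :
    MonotoneOn (majorant C D T u) (Ico 0 T) := by
  intro s hs t ht hst
  have h1 := arcLength_mono (hbv t ht) hs.1 hst
  have h2 : (⌈T / (T - s)⌉ : ℝ) ≤ ⌈T / (T - t)⌉ := by
    exact_mod_cast Int.ceil_mono (monotoneOn_div_sub hT hs ht hst)
  simp only [majorant]
  gcongr

/-- `T / (T - t)` equals the integer `j + 2` at the excursion time and exceeds it afterwards, so its
ceiling gains at least one. That unit pays for the excursion. -/
theorem majorant_sub_of_excursionTime_lt {C D : ℝ} (hC : 0 ≤ C) (hD : 0 ≤ D) (hT : 0 < T)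
    (hbv : ∀ t ∈ Ico 0 T, BoundedVariationOn u (Icc 0 t)) {j : ℕ} {t : ℝ} (ht : t < T)
    (hjt : excursionTime T j < t) :
    3 * C * D ≤ majorant C D T u t - majorant C D T u (excursionTime T j) := by
  have hj := excursionTime_mem_Ioo hT j
  have ht' : t ∈ Ico 0 T := ⟨(hj.1.trans hjt).le, ht⟩
  have h1 := arcLength_mono (hbv t ht') hj.1.le hjt.le
  have h2 : (⌈T / (T - excursionTime T j)⌉ : ℝ) + 1 ≤ ⌈T / (T - t)⌉ := by
    have h3 := strictMonoOn_div_sub hT ⟨hj.1.le, hj.2⟩ ht' hjt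
    simp only [div_sub_excursionTime hT] at h3 ⊢
    have h4 : ⌈((j : ℝ) + 2)⌉ = (j : ℤ) + 2 := by
      rw [show ((j : ℝ) + 2) = (((j : ℤ) + 2 : ℤ) : ℝ) by push_cast; rfl, Int.ceil_intCast]
    have h5 : (j : ℤ) + 2 < ⌈T / (T - t)⌉ := by
      rw [Int.lt_ceil]
      push_cast
      exact h3
    rw [h4]
    exact_mod_cast h5
  have h6 : 3 * C * D * ((⌈T / (T - excursionTime T j)⌉ : ℝ) + 1) ≤ 3 * C * D * ⌈T / (T - t)⌉ := by
    gcongr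
  have h7 : C * arcLength u (excursionTime T j) ≤ C * arcLength u t := by gcongr
  simp only [majorant]
  linarith

variable [NormedSpace ℝ F]

/-- An ordinary step is one Whitney path, of length at most `C` times the increment of `u`. A step
starting at an excursion time runs through `u T` and `w` before reaching the next grid value: three
paths of length at most `C * D` each, covered by the jump of the majorant. -/
theorem exists_isApproxControl {C : ℝ≥0} {D : ℝ} (hT : 0 < T)
    (hU : ∀ u₁ ∈ U, ∀ u₂ ∈ U, ∃ γ : ℝ → F, LipschitzOnWith (C * nndist u₁ u₂) γ (Icc 0 1) ∧
      (∀ s ∈ Icc (0 : ℝ) 1, γ s ∈ U) ∧ γ 0 = u₁ ∧ γ 1 = u₂)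
    (hD : ∀ a ∈ U, ∀ b ∈ U, ‖a - b‖ ≤ D) (hu : ∀ t ∈ Icc 0 T, u t ∈ U)
    (hbv : ∀ t ∈ Ico 0 T, BoundedVariationOn u (Icc 0 t)) {w : F} (hw : w ∈ U) {P : Finset ℝ}
    (hP : ∀ p ∈ P, p ∈ Icc 0 T) (h0 : 0 ∈ P) (hTP : T ∈ P) :
    ∃ z, IsApproxControl U T u (majorant C D T u) (3 * C * D) w P z := by
  have hTU : u T ∈ U := hu T ⟨hT.le, le_rfl⟩
  have hD0 : 0 ≤ D := (norm_nonneg _).trans (hD _ hw _ hw)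
  have hC0 : (0 : ℝ) ≤ C := C.coe_nonneg
  have hCD : 0 ≤ C * D := mul_nonneg hC0 hD0
  have hmono := monotoneOn_majorant hC0 hD0 hT hbv
  set Ψ := majorant C D T u with hΨ
  -- The absolute bound also covers the step ending at `T`. The bound by the majorant is asked only
  -- for `q < T`, since nothing controls the increment of `u` at `T`.
  set Q : ℝ → ℝ → (ℝ → F) → Prop := fun p q δ =>
    eVariationOn δ (Icc p q) ≤ ENNReal.ofReal (3 * C * D) ∧
    (q < T → eVariationOn δ (Icc p q) ≤ ENNReal.ofReal (Ψ q - Ψ p)) ∧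
    ∀ j, p = excursionTime T j → ∃ θ θ', p < θ ∧ θ < θ' ∧ θ' < q ∧ δ θ = u T ∧ δ θ' = w with hQdef
  have hQ : ∀ p q δ δ', EqOn δ δ' (Icc p q) → Q p q δ → Q p q δ' := by
    rintro p q δ δ' he ⟨h1, h2, h3⟩
    rw [hQdef]
    simp only
    rw [← eVariationOn.congr he]
    refine ⟨h1, h2, fun j hj => ?_⟩
    obtain ⟨θ, θ', ha, hb, hc, hd, he'⟩ := h3 j hj
    exact ⟨θ, θ', ha, hb, hc, by rw [← he ⟨ha.le, (hb.trans hc).le⟩, hd],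
      by rw [← he ⟨(ha.trans hb).le, hc.le⟩, he']⟩
  have hstep : ∀ p ∈ Icc 0 T, ∀ q ∈ Icc 0 T, p < q →
      ∃ δ, IsLipschitzPath U p q δ ∧ δ p = u p ∧ δ q = u q ∧ Q p q δ := by
    intro p hp q hq hpq
    by_cases hj : ∃ j, p = excursionTime T j
    · set h := (q - p) / 3 with hh
      have h3 : 0 < h := by have := sub_pos.2 hpq; positivity
      have e1 : p < p + h := by linarith
      have e2 : p + h < p + 2 * h := by linarith
      have e3 : p + 2 * h < q := by have : q - p = 3 * h := by rw [hh]; ring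
                                    linarith
      obtain ⟨δ₁, hδ₁, a₁, b₁, v₁⟩ := exists_isLipschitzPath_of_unitInterval hU (hu p hp) hTU e1
      obtain ⟨δ₂, hδ₂, a₂, b₂, v₂⟩ := exists_isLipschitzPath_of_unitInterval hU hTU hw e2
      obtain ⟨δ₃, hδ₃, a₃, b₃, v₃⟩ := exists_isLipschitzPath_of_unitInterval hU hw (hu q hq) e3
      obtain ⟨δ₄, hδ₄, f₁, f₂⟩ := hδ₁.exists_glue hδ₂ (b₁.trans a₂.symm)
      have hδ₄w : δ₄ (p + 2 * h) = w := (f₂ e2.le).trans b₂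
      obtain ⟨δ, hδ, g₁, g₂⟩ := hδ₄.exists_glue hδ₃ (hδ₄w.trans a₃.symm)
      have c₁ : EqOn δ₁ δ (Icc p (p + h)) := fun t ht =>
        ((g₁ (ht.2.trans e2.le)).trans (f₁ ht.2)).symm
      have c₂ : EqOn δ₂ δ (Icc (p + h) (p + 2 * h)) := fun t ht =>
        ((g₁ ht.2).trans (f₂ ht.1)).symm
      have c₃ : EqOn δ₃ δ (Icc (p + 2 * h) q) := fun t ht => (g₂ ht.1).symm
      have hb : ∀ a ∈ U, ∀ b ∈ U, ENNReal.ofReal (C * ‖a - b‖) ≤ ENNReal.ofReal (C * D) :=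
        fun a ha b hb => ENNReal.ofReal_le_ofReal (by gcongr; exact hD a ha b hb)
      have hvar : eVariationOn δ (Icc p q) ≤ ENNReal.ofReal (3 * C * D) := by
        have s₁ := eVariationOn.Icc_add_Icc δ (s := univ) (e1.trans e2).le e3.le (mem_univ _)
        have s₂ := eVariationOn.Icc_add_Icc δ (s := univ) e1.le e2.le (mem_univ _)
        simp only [univ_inter] at s₁ s₂
        rw [← s₁, ← s₂, ← eVariationOn.congr c₁, ← eVariationOn.congr c₂, ← eVariationOn.congr c₃]
        refine (add_le_add (add_le_add (v₁.trans (hb _ hTU _ (hu p hp)))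
          (v₂.trans (hb _ hw _ hTU))) (v₃.trans (hb _ (hu q hq) _ hw))).trans (le_of_eq ?_)
        rw [← ENNReal.ofReal_add hCD hCD, ← ENNReal.ofReal_add (by positivity) hCD]
        congr 1
        ring
      refine ⟨δ, hδ, ?_, ?_, hvar, fun hqT => ?_, fun j _ => ?_⟩
      · rw [← c₁ ⟨le_rfl, e1.le⟩, a₁]
      · rw [← c₃ ⟨e3.le, le_rfl⟩, b₃]
      · obtain ⟨j, rfl⟩ := hj
        exact hvar.trans (ENNReal.ofReal_le_ofReal
          (majorant_sub_of_excursionTime_lt hC0 hD0 hT hbv hqT hpq))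
      · exact ⟨p + h, p + 2 * h, e1, e2, e3, by rw [← c₂ ⟨le_rfl, e2.le⟩, a₂],
          by rw [← c₂ ⟨e2.le, le_rfl⟩, b₂]⟩
    · obtain ⟨δ, hδ, a₁, b₁, v₁⟩ :=
        exists_isLipschitzPath_of_unitInterval hU (hu p hp) (hu q hq) hpq
      refine ⟨δ, hδ, a₁, b₁, ?_, fun hqT => ?_, fun j hj' => absurd ⟨j, hj'⟩ hj⟩
      · refine v₁.trans (ENNReal.ofReal_le_ofReal ?_)
        have := mul_le_mul_of_nonneg_left (hD _ (hu q hq) _ (hu p hp)) hC0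
        linarith
      · refine v₁.trans (ENNReal.ofReal_le_ofReal ?_)
        have h1 := norm_sub_le_arcLength_sub (hbv q ⟨hq.1, hqT⟩) hp.1 hpq.le
        have h2 : (⌈T / (T - p)⌉ : ℝ) ≤ ⌈T / (T - q)⌉ := by
          exact_mod_cast Int.ceil_mono
            (monotoneOn_div_sub hT ⟨hp.1, hpq.trans hqT⟩ ⟨hq.1, hqT⟩ hpq.le)
        have h3 := mul_le_mul_of_nonneg_left h1 hC0
        have h4 : 3 * C * D * (⌈T / (T - p)⌉ : ℝ) ≤ 3 * C * D * ⌈T / (T - q)⌉ := by gcongr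
        simp only [hΨ, majorant]
        linarith
  obtain ⟨z, hz1, hz2, hz3⟩ := exists_interpolation hu Q hQ hstep P hP
  have hz := hz1 0 h0 T hTP
  obtain ⟨K, hK⟩ := hz.lipschitz
  have hbvz : ∀ t ≤ T, BoundedVariationOn z (Icc 0 t) := fun t ht =>
    hK.boundedVariationOn_Icc.mono (Icc_subset_Icc_right ht)
  have harc : ∀ {p q b : ℝ}, 0 ≤ p → p ≤ q → q ≤ T → 0 ≤ b →
      eVariationOn z (Icc p q) ≤ ENNReal.ofReal b → arcLength z q - arcLength z p ≤ b := by
    intro p q b hp hpq hq hb h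
    rw [← arcLength_add (hbvz q hq) hp hpq, add_sub_cancel_left]
    exact ENNReal.toReal_le_of_le_ofReal hb h
  refine ⟨z, ⟨K, hK⟩, hz.mem, hz2, fun s hs => ?_, fun p hp q hq hpq hqT => ?_, fun j hj => ?_⟩
  · obtain ⟨p, q, hcons, hps, hsq⟩ := exists_consecutive h0 hTP hs.1 hs.2
    have hp := hP p hcons.1
    have hq := hP q hcons.2.1
    exact ⟨p, hcons.1, q, hcons.2.1, hp.1, hps, hsq, hq.2,
      harc hp.1 hcons.2.2.1.le hq.2 (by positivity) (hz3 p q hcons).1⟩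
  · refine harc (hP p hp).1 hpq hqT.le (sub_nonneg.2 (hmono ⟨(hP p hp).1, hpq.trans_lt hqT⟩
      ⟨(hP q hq).1, hqT⟩ hpq)) ?_
    exact eVariationOn_Icc_le_of_consecutive hmono (fun p hp => (hP p hp).1)
      (fun p q h => (hz3 p q h).2.1) hp hq hpq hqT
  · obtain ⟨p, q, hcons, hps, hsq⟩ := exists_consecutive h0 hTP (excursionTime_mem_Ioo hT j).1.le
      (excursionTime_mem_Ioo hT j).2
    have hpj : p = excursionTime T j := by
      rcases hcons.2.2.2 _ hj with h | h
      · exact le_antisymm hps h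
      · exact absurd hsq h.not_gt
    obtain ⟨θ, θ', h1, h2, h3, h4, h5⟩ := (hz3 p q hcons).2.2 j hpj
    refine ⟨θ, θ', hpj ▸ h1, h2, h3.trans_le (hP q hcons.2.1).2, fun r hr => ?_, h4, h5⟩
    rcases hcons.2.2.2 r hr with h | h
    · exact Or.inl (hpj ▸ h)
    · exact Or.inr (h3.le.trans h)

end Existence

/-! ### Refining grids and asymptotics of the controls -/

theorem exists_finset_exhaustion {T : ℝ} (hT : 0 < T) {D : Set ℝ} (hD : D.Countable)
    (hDT : D ⊆ Icc 0 T) :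
    ∃ P : ℕ → Finset ℝ, (∀ k, ∀ p ∈ P k, p ∈ Icc 0 T) ∧ (∀ k, 0 ∈ P k) ∧ (∀ k, T ∈ P k) ∧
      (∀ d ∈ D, ∀ᶠ k in atTop, d ∈ P k) ∧
      ∀ a b, 0 ≤ a → a < b → b ≤ T → ∀ᶠ k in atTop, ∃ p ∈ P k, a < p ∧ p < b := by
  classical
  set D' : Set ℝ := insert 0 (D ∪ (range ((↑) : ℚ → ℝ) ∩ Icc 0 T)) with hD'
  have hc : D'.Countable := (hD.union ((countable_range _).mono inter_subset_left)).insert 0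
  have hDT' : D' ⊆ Icc 0 T :=
    insert_subset ⟨le_rfl, hT.le⟩ (union_subset hDT inter_subset_right)
  obtain ⟨d, hd⟩ := hc.exists_eq_range (insert_nonempty _ _)
  have hev : ∀ x ∈ D', ∀ᶠ k in atTop,
      x ∈ insert 0 (insert T ((Finset.range (k + 1)).image d)) := by
    intro x hx
    rw [hd] at hx
    obtain ⟨i, rfl⟩ := hx
    filter_upwards [eventually_ge_atTop i] with k hk
    simp only [Finset.mem_insert, Finset.mem_image, Finset.mem_range]
    exact Or.inr (Or.inr ⟨i, by omega, rfl⟩)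
  refine ⟨fun k => insert 0 (insert T ((Finset.range (k + 1)).image d)), fun k p hp => ?_,
    fun k => by simp, fun k => by simp, fun x hx => hev x (Or.inr (Or.inl hx)),
    fun a b ha hab hb => ?_⟩
  · simp only [Finset.mem_insert, Finset.mem_image] at hp
    rcases hp with rfl | rfl | ⟨i, _, rfl⟩
    · exact ⟨le_rfl, hT.le⟩
    · exact ⟨hT.le, le_rfl⟩
    · exact hDT' (hd ▸ mem_range_self i)
  · obtain ⟨q, hq1, hq2⟩ := exists_rat_btwn hab
    have : (q : ℝ) ∈ D' := Or.inr (Or.inr ⟨mem_range_self q, by constructor <;> linarith⟩)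
    filter_upwards [hev q this] with k hk
    exact ⟨q, hk, hq1, hq2⟩

section Asymptotics

variable {F : Type*} [NormedAddCommGroup F] {U : Set F} {u : ℝ → F} {T B : ℝ} {Ψ : ℝ → ℝ} {w : F}

namespace IsApproxControl

variable {P : Finset ℝ} {z : ℝ → F}

theorem boundedVariationOn (h : IsApproxControl U T u Ψ B w P z) {t : ℝ} (ht : t ≤ T) :
    BoundedVariationOn z (Icc 0 t) := by
  obtain ⟨K, hK⟩ := h.lipschitz
  exact hK.boundedVariationOn_Icc.mono (Icc_subset_Icc_right ht)

theorem arcLength_le (h : IsApproxControl U T u Ψ B w P z) {s t : ℝ} (hs : 0 ≤ s) (hst : s ≤ t)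
    (ht : t ≤ T) : arcLength z s ≤ arcLength z t :=
  arcLength_mono (h.boundedVariationOn ht) hs hst

/-- Length up to the last grid point before `t` is controlled by `Ψ`; the step in progress at `t`
adds at most `B`. This is the variation bound uniform in the grid. -/
theorem arcLength_le_majorant (h : IsApproxControl U T u Ψ B w P z)
    (hΨ : MonotoneOn Ψ (Ico 0 T)) (h0 : 0 ∈ P) {t : ℝ} (ht : t ∈ Ico 0 T) :
    arcLength z t ≤ Ψ t - Ψ 0 + B := by
  obtain ⟨p, hp, q, hq, hp0, hpt, htq, hqT, hB⟩ := h.exists_step t ht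
  have h1 := h.arcLength_sub_le 0 h0 p hp hp0 (hpt.trans_lt ht.2)
  have h2 := h.arcLength_le ht.1 htq.le hqT
  have h3 : Ψ p ≤ Ψ t := hΨ ⟨hp0, hpt.trans_lt ht.2⟩ ht hpt
  rw [arcLength_zero] at h1
  linarith

end IsApproxControl

variable {P : ℕ → Finset ℝ} {z : ℕ → ℝ → F}

/-- The points `s₀` and `s₁` do not depend on `k`, although the enclosing grid points do. Hence one
neighbourhood of a continuity point of `Ψ` serves all large `k`. -/
theorem eventually_exists_majorant_sub_le
    (hdense : ∀ a b, 0 ≤ a → a < b → b ≤ T → ∀ᶠ k in atTop, ∃ p ∈ P k, a < p ∧ p < b)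
    {t : ℝ} (ht : t ∈ Ioo 0 T) (hΨt : ContinuousWithinAt Ψ (Ico 0 T) t) {ε : ℝ} (hε : 0 < ε) :
    ∃ s₀ s₁, 0 ≤ s₀ ∧ s₀ < t ∧ t < s₁ ∧ s₁ < T ∧ ∀ᶠ k in atTop, ∃ p ∈ P k, ∃ q ∈ P k,
      0 ≤ p ∧ p < s₀ ∧ s₁ < q ∧ q < T ∧ Ψ q - Ψ p ≤ ε := by
  have h1 : ContinuousAt Ψ t := hΨt.continuousAt (Ico_mem_nhds ht.1 ht.2)
  have h2 : ∀ᶠ r in 𝓝 t, dist (Ψ r) (Ψ t) < ε / 2 ∧ r ∈ Ioo 0 T :=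
    (Metric.tendsto_nhds.1 h1 (ε / 2) (by positivity)).and (Ioo_mem_nhds ht.1 ht.2)
  obtain ⟨δ, hδ, hball⟩ := Metric.eventually_nhds_iff.1 h2
  have hin : ∀ r, |r - t| < δ → |Ψ r - Ψ t| < ε / 2 ∧ r ∈ Ioo 0 T := fun r hr => hball hr
  have ha := hin (t - δ / 2) (by rw [abs_lt]; constructor <;> linarith)
  have hb := hin (t + δ / 2) (by rw [abs_lt]; constructor <;> linarith)
  refine ⟨t - δ / 4, t + δ / 4, by linarith [ha.2.1], by linarith, by linarith,
    by linarith [hb.2.2], ?_⟩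
  filter_upwards [hdense (t - δ / 2) (t - δ / 4) ha.2.1.le (by linarith) (by linarith [ht.2]),
    hdense (t + δ / 4) (t + δ / 2) (by linarith [ht.1]) (by linarith) hb.2.2.le] with k hp hq
  obtain ⟨p, hp, hp1, hp2⟩ := hp
  obtain ⟨q, hq, hq1, hq2⟩ := hq
  have h3 := abs_lt.1 (hin p (by rw [abs_lt]; constructor <;> linarith)).1
  have h4 := abs_lt.1 (hin q (by rw [abs_lt]; constructor <;> linarith)).1
  exact ⟨p, hp, q, hq, by linarith [ha.2.1], hp2, hq1, by linarith [hb.2.2], by linarith⟩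

theorem eventually_arcLength_sub_le (hz : ∀ k, IsApproxControl U T u Ψ B w (P k) (z k))
    (hdense : ∀ a b, 0 ≤ a → a < b → b ≤ T → ∀ᶠ k in atTop, ∃ p ∈ P k, a < p ∧ p < b)
    {t : ℝ} (ht : t ∈ Ioo 0 T) (hΨt : ContinuousWithinAt Ψ (Ico 0 T) t) {ε : ℝ} (hε : 0 < ε) :
    ∃ s₀ s₁, 0 ≤ s₀ ∧ s₀ < t ∧ t < s₁ ∧ s₁ < T ∧
      ∀ᶠ k in atTop, arcLength (z k) s₁ - arcLength (z k) s₀ ≤ ε := by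
  obtain ⟨s₀, s₁, h0, h1, h2, h3, hev⟩ := eventually_exists_majorant_sub_le hdense ht hΨt hε
  refine ⟨s₀, s₁, h0, h1, h2, h3, ?_⟩
  filter_upwards [hev] with k hk
  obtain ⟨p, hp, q, hq, hp0, hps, hsq, hqT, hle⟩ := hk
  have e1 := (hz k).arcLength_sub_le p hp q hq (by linarith) hqT
  have e2 := (hz k).arcLength_le hp0 hps.le (by linarith)
  have e3 := (hz k).arcLength_le (by linarith) hsq.le hqT.le
  linarith

/-- At a continuity point of `Ψ`, pick a grid point `p` just before `t`. There the control equals `u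
p`, and from `p` to `t` both the control and `u` move by no more than the small increment of `Ψ`. -/
theorem tendsto_of_isApproxControl (hz : ∀ k, IsApproxControl U T u Ψ B w (P k) (z k))
    (hdense : ∀ a b, 0 ≤ a → a < b → b ≤ T → ∀ᶠ k in atTop, ∃ p ∈ P k, a < p ∧ p < b)
    (hΨ : MonotoneOn Ψ (Ico 0 T))
    (hΨu : ∀ s t, 0 ≤ s → s ≤ t → t < T → ‖u t - u s‖ ≤ Ψ t - Ψ s) {t : ℝ}
    (ht : (∀ᶠ k in atTop, t ∈ P k) ∨ t ∈ Ioo 0 T ∧ ContinuousWithinAt Ψ (Ico 0 T) t) :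
    Tendsto (fun k => z k t) atTop (𝓝 (u t)) := by
  rcases ht with ht | ⟨ht, hΨt⟩
  · refine tendsto_const_nhds.congr' ?_
    filter_upwards [ht] with k hk
    exact ((hz k).eq_of_mem t hk).symm
  · rw [Metric.tendsto_nhds]
    intro ε hε
    obtain ⟨s₀, s₁, h0, h1, h2, h3, hev⟩ :=
      eventually_exists_majorant_sub_le hdense ht hΨt (half_pos (half_pos hε))
    filter_upwards [hev] with k hk
    obtain ⟨p, hp, q, hq, hp0, hps, hsq, hqT, hle⟩ := hk
    have hpt : p ≤ t := by linarith
    have e1 := (hz k).arcLength_sub_le p hp q hq (by linarith) hqT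
    have e2 := (hz k).arcLength_le ht.1.le (by linarith : t ≤ q) hqT.le
    have e3 := norm_sub_le_arcLength_sub ((hz k).boundedVariationOn ht.2.le) hp0 hpt
    have e4 := hΨu p t hp0 hpt ht.2
    have e5 : Ψ t ≤ Ψ q := hΨ ⟨ht.1.le, ht.2⟩ ⟨by linarith, hqT⟩ (by linarith)
    rw [(hz k).eq_of_mem p hp] at e3
    rw [dist_eq_norm]
    have e6 : ‖z k t - u t‖ ≤ ‖z k t - u p‖ + ‖u t - u p‖ := by
      rw [← sub_sub_sub_cancel_right (z k t) (u t) (u p)]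
      exact norm_sub_le _ _
    linarith

/-- A monotone function has one-sided limits, so its oscillation on a punctured one-sided
neighbourhood is small even when it jumps at `t`. -/
theorem exists_left_majorant_le (hΨ : MonotoneOn Ψ (Ico 0 T)) {t : ℝ} (ht : t ∈ Ioo 0 T) :
    ∃ s, 0 ≤ s ∧ s < t ∧ ∀ p q, s ≤ p → p ≤ q → q < t → Ψ q - Ψ p ≤ 1 := by
  have hne : (Ψ '' Ico 0 t).Nonempty := ⟨Ψ 0, 0, ⟨le_rfl, ht.1⟩, rfl⟩
  have hb : BddAbove (Ψ '' Ico 0 t) := by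
    refine ⟨Ψ t, ?_⟩
    rintro _ ⟨r, hr, rfl⟩
    exact hΨ ⟨hr.1, hr.2.trans ht.2⟩ ⟨ht.1.le, ht.2⟩ hr.2.le
  obtain ⟨_, ⟨s, hs, rfl⟩, hlt⟩ := exists_lt_of_lt_csSup hne (sub_one_lt (sSup (Ψ '' Ico 0 t)))
  refine ⟨s, hs.1, hs.2, fun p q hp hpq hq => ?_⟩
  have h1 : Ψ q ≤ sSup (Ψ '' Ico 0 t) := le_csSup hb ⟨q, ⟨by linarith [hs.1], hq⟩, rfl⟩
  have h2 : Ψ s ≤ Ψ p := hΨ ⟨hs.1, hs.2.trans ht.2⟩ ⟨by linarith [hs.1], by linarith [ht.2]⟩ hp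
  linarith

theorem exists_right_majorant_le (hΨ : MonotoneOn Ψ (Ico 0 T)) {t : ℝ} (ht : t ∈ Ico 0 T) :
    ∃ s, t < s ∧ s < T ∧ ∀ p q, t < p → p ≤ q → q ≤ s → Ψ q - Ψ p ≤ 1 := by
  have hne : (Ψ '' Ioo t T).Nonempty := (nonempty_Ioo.2 ht.2).image _
  have hb : BddBelow (Ψ '' Ioo t T) := by
    refine ⟨Ψ t, ?_⟩
    rintro _ ⟨r, hr, rfl⟩
    exact hΨ ht ⟨ht.1.trans hr.1.le, hr.2⟩ hr.1.le
  obtain ⟨_, ⟨s, hs, rfl⟩, hlt⟩ := exists_lt_of_csInf_lt hne (lt_add_one (sInf (Ψ '' Ioo t T)))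
  refine ⟨s, hs.1, hs.2, fun p q hp hpq hq => ?_⟩
  have h1 : sInf (Ψ '' Ioo t T) ≤ Ψ p := csInf_le hb ⟨p, ⟨hp, by linarith [hs.2]⟩, rfl⟩
  have h2 : Ψ q ≤ Ψ s := hΨ ⟨by linarith [ht.1], by linarith [hs.2]⟩
    ⟨by linarith [ht.1, hs.1], hs.2⟩ hq
  linarith

/-- Up to a bounded length, every point of `[0,τ]` can be replaced by one of finitely many. -/
theorem exists_finset_arcLength_sub_le (hz : ∀ k, IsApproxControl U T u Ψ B w (P k) (z k))
    (hdense : ∀ a b, 0 ≤ a → a < b → b ≤ T → ∀ᶠ k in atTop, ∃ p ∈ P k, a < p ∧ p < b)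
    (hΨ : MonotoneOn Ψ (Ico 0 T)) (hB : 0 ≤ B) {τ : ℝ} (hτ : τ < T) :
    ∃ G : Finset ℝ, (∀ r ∈ G, r ∈ Ico 0 T) ∧ ∀ᶠ k in atTop, ∀ s ∈ Icc 0 τ, ∃ r ∈ G,
      |arcLength (z k) s - arcLength (z k) r| ≤ B + 1 := by
  classical
  -- Compactness reduces to a neighbourhood of one `t`. The jump of `Ψ` at `t` may be large, so
  -- times before `t`, the time `t` itself and times after `t` get separate representatives. Each
  -- side then costs at most `1` from `Ψ` and `B` from the step in progress, which makes `B + 1`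
  -- independent of `τ`.
  refine isCompact_Icc.induction_on (s := Icc 0 τ) (p := fun A =>
    ∃ G : Finset ℝ, (∀ r ∈ G, r ∈ Ico 0 T) ∧ ∀ᶠ k in atTop, ∀ s ∈ A, ∃ r ∈ G,
      |arcLength (z k) s - arcLength (z k) r| ≤ B + 1) ⟨∅, by simp, by simp⟩ ?_ ?_ ?_
  · rintro A A' hAA' ⟨G, hG, h⟩
    exact ⟨G, hG, h.mono fun k hk s hs => hk s (hAA' hs)⟩
  · rintro A A' ⟨G, hG, h⟩ ⟨G', hG', h'⟩
    refine ⟨G ∪ G', fun r hr => ?_, ?_⟩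
    · rcases Finset.mem_union.1 hr with hr | hr
      exacts [hG r hr, hG' r hr]
    · filter_upwards [h, h'] with k hk hk'
      rintro s (hs | hs)
      · obtain ⟨r, hr, hle⟩ := hk s hs
        exact ⟨r, Finset.mem_union_left _ hr, hle⟩
      · obtain ⟨r, hr, hle⟩ := hk' s hs
        exact ⟨r, Finset.mem_union_right _ hr, hle⟩
  · intro t ht
    have htT : t ∈ Ico 0 T := ⟨ht.1, ht.2.trans_lt hτ⟩
    have hself : ∀ k, |arcLength (z k) t - arcLength (z k) t| ≤ B + 1 := fun k => by
      rw [sub_self, abs_zero]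
      linarith
    obtain ⟨s₁, hts₁, hs₁T, hs₁⟩ := exists_right_majorant_le hΨ htT
    have hright : ∃ r₁, t < r₁ ∧ r₁ < T ∧ ∀ᶠ k in atTop, ∀ s, t < s → s ≤ r₁ →
        |arcLength (z k) s - arcLength (z k) r₁| ≤ B + 1 := by
      refine ⟨(t + s₁) / 2, by linarith, by linarith, ?_⟩
      filter_upwards [hdense ((t + s₁) / 2) s₁ (by linarith [ht.1]) (by linarith) hs₁T.le]
        with k hk s hts hsr
      obtain ⟨q, hq, hq1, hq2⟩ := hk
      have hs : s ∈ Ico 0 T := ⟨by linarith [ht.1], by linarith⟩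
      obtain ⟨p', hp', q', hq', hp0, hps, hsq, hqT, hB'⟩ := (hz k).exists_step s hs
      have e0 := (hz k).arcLength_le hs.1 hsr (by linarith)
      have e1 := (hz k).arcLength_le hp0 hps hs.2.le
      rw [abs_sub_comm, abs_of_nonneg (sub_nonneg.2 e0)]
      rcases le_total q' q with h | h
      · have e2 := (hz k).arcLength_sub_le q' hq' q hq h (by linarith)
        have e3 := hs₁ q' q (by linarith) h hq2.le
        have e4 := (hz k).arcLength_le (by linarith [ht.1]) hq1.le (by linarith)
        linarith
      · have e2 := (hz k).arcLength_le (by linarith [ht.1]) (hq1.le.trans h) hqT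
        linarith
    obtain ⟨r₁, htr₁, hr₁T, hr₁⟩ := hright
    have hleft : ∃ r₀, r₀ < t ∧ (t ≠ 0 → 0 ≤ r₀) ∧ ∀ᶠ k in atTop, ∀ s, 0 ≤ s → r₀ ≤ s → s < t →
        |arcLength (z k) s - arcLength (z k) r₀| ≤ B + 1 := by
      rcases ht.1.eq_or_lt with rfl | h0
      -- At `t = 0` there is nothing to the left; the negative value is a dummy, left out of the
      -- finite set below.
      · exact ⟨-1, by norm_num, fun h => absurd rfl h,
          Eventually.of_forall fun k s hs _ hs' => absurd hs hs'.not_ge⟩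
      obtain ⟨s₀, hs₀0, hs₀t, hs₀⟩ := exists_left_majorant_le hΨ ⟨h0, htT.2⟩
      refine ⟨(s₀ + t) / 2, by linarith, fun _ => by linarith, ?_⟩
      filter_upwards [hdense s₀ ((s₀ + t) / 2) hs₀0 (by linarith) (by linarith [htT.2])]
        with k hk s hs0 hrs hst
      obtain ⟨q, hq, hq1, hq2⟩ := hk
      obtain ⟨p', hp', q', hq', hp0, hps, hsq, hqT, hB'⟩ :=
        (hz k).exists_step s ⟨hs0, hst.trans htT.2⟩
      have e0 := (hz k).arcLength_le (by linarith) hrs (hst.trans htT.2).le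
      have e1 := (hz k).arcLength_le hs0 hsq.le hqT
      rw [abs_of_nonneg (sub_nonneg.2 e0)]
      rcases le_total q p' with h | h
      · have e2 := (hz k).arcLength_sub_le q hq p' hp' h (by linarith [htT.2])
        have e3 := hs₀ q p' hq1.le h (by linarith)
        have e4 := (hz k).arcLength_le (by linarith) hq2.le (by linarith [htT.2])
        linarith
      · have e2 := (hz k).arcLength_le hp0 (h.trans hq2.le) (by linarith [htT.2])
        linarith
    obtain ⟨r₀, hr₀t, hr₀0, hr₀⟩ := hleft
    refine ⟨Icc 0 τ ∩ Ioo r₀ r₁, inter_mem self_mem_nhdsWithin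
      (mem_nhdsWithin_of_mem_nhds (Ioo_mem_nhds hr₀t htr₁)),
      if t = 0 then {t, r₁} else {t, r₁, r₀}, ?_, ?_⟩
    · have e1 : r₁ ∈ Ico 0 T := ⟨by linarith [ht.1], hr₁T⟩
      split_ifs with h
      · simp only [Finset.mem_insert, Finset.mem_singleton, forall_eq_or_imp, forall_eq]
        exact ⟨htT, e1⟩
      · have : r₀ ∈ Ico 0 T := ⟨hr₀0 h, hr₀t.trans htT.2⟩
        simp only [Finset.mem_insert, Finset.mem_singleton, forall_eq_or_imp, forall_eq]
        exact ⟨htT, e1, this⟩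
    · filter_upwards [hr₀, hr₁] with k h0 h1 s hs
      rcases lt_trichotomy s t with h | rfl | h
      · refine ⟨r₀, ?_, h0 s hs.1.1 hs.2.1.le h⟩
        have : t ≠ 0 := fun h' => by linarith [hs.1.1]
        simp [this]
      · exact ⟨s, by split_ifs <;> simp, hself k⟩
      · exact ⟨r₁, by split_ifs <;> simp, h1 s h hs.2.2.le⟩

end Asymptotics

/-! ### Diagonal extraction -/

/-- A countable product of compact metric sets is sequentially compact, which replaces the explicit
diagonal argument. -/
theorem exists_strictMono_forall_tendsto {ι E : Type*} [Countable ι] [MetricSpace E]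
    [ProperSpace E] {f : ι → ℕ → E} (hf : ∀ i, Bornology.IsBounded (range (f i))) :
    ∃ φ : ℕ → ℕ, StrictMono φ ∧ ∀ i, ∃ a, Tendsto (fun k => f i (φ k)) atTop (𝓝 a) := by
  have hK : IsCompact (univ.pi fun i => closure (range (f i))) :=
    isCompact_univ_pi fun i => (hf i).isCompact_closure
  obtain ⟨a, _, φ, hφ, h⟩ := hK.tendsto_subseq (x := fun k i => f i k)
    (fun k i _ => subset_closure (mem_range_self k))
  exact ⟨φ, hφ, fun i => ⟨a i, tendsto_pi_nhds.1 h i⟩⟩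

theorem cauchySeq_of_forall_approx {E : Type*} [PseudoMetricSpace E] {a : ℕ → E}
    (h : ∀ ε > 0, ∃ b : ℕ → E, CauchySeq b ∧ ∀ᶠ k in atTop, dist (a k) (b k) ≤ ε) :
    CauchySeq a := by
  rw [Metric.cauchySeq_iff]
  intro ε hε
  obtain ⟨b, hb, hab⟩ := h (ε / 4) (by positivity)
  obtain ⟨N₁, h1⟩ := Metric.cauchySeq_iff.1 hb (ε / 4) (by positivity)
  obtain ⟨N₂, h2⟩ := eventually_atTop.1 hab
  refine ⟨max N₁ N₂, fun i hi j hj => ?_⟩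
  have e1 := h1 i (le_trans (le_max_left _ _) hi) j (le_trans (le_max_left _ _) hj)
  have e2 := h2 i (le_trans (le_max_right _ _) hi)
  have e3 := h2 j (le_trans (le_max_right _ _) hj)
  rw [dist_comm] at e3
  have := dist_triangle4 (a i) (b i) (b j) (a j)
  linarith

/-! ### Convergent trajectories with excursions -/

namespace ImpulsiveSystem

variable {n m l : ℕ} {S : ImpulsiveSystem n m l}

section

variable {N c T : ℝ} {u : ℝ → EuclideanSpace ℝ (Fin m)} {v : ℝ → EuclideanSpace ℝ (Fin l)}
  {x : ℝ → EuclideanSpace ℝ (Fin n)}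

/-- Solutions at two times are comparable when the control is short in between. -/
theorem IsLipschitzSolution.add_norm_le_of_abs_arcLength_sub_le {K : ℝ≥0} {s t A : ℝ}
    (h : S.IsLipschitzSolution 0 T u v x) (hNc : S.GrowthBound N c)
    (hu : LipschitzOnWith K u (Icc 0 T)) (huU : ∀ t ∈ Icc 0 T, u t ∈ S.U)
    (hv : ∀ᵐ t ∂(volume.restrict (Icc 0 T)), v t ∈ S.V) (hs : s ∈ Icc 0 T) (ht : t ∈ Icc 0 T)
    (hA : |arcLength u t - arcLength u s| ≤ A) :
    c + ‖x t‖ ≤ Real.exp (N * (T + A)) * (c + ‖x s‖) := by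
  have hc := hNc.2.1
  have hN := hNc.1
  have hA' := abs_le.1 hA
  have key : ∀ {p q r : ℝ}, p ∈ Icc 0 T → q ∈ Icc 0 T → arcLength u q - arcLength u p ≤ A →
      Real.exp (gauge N u q - gauge N u p) * (c + ‖x r‖) ≤
      Real.exp (N * (T + A)) * (c + ‖x r‖) := by
    intro p q r hp hq hle
    have : 0 ≤ c + ‖x r‖ := by positivity
    gcongr
    rw [gauge, gauge, ← mul_sub]
    gcongr
    linarith [hp.1, hq.2]
  rcases le_total s t with hst | hts
  · refine (((h.mono hs.1 ht.2).gronwall hNc hu huU hv hs.1 hst ht.2).1).trans ?_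
    exact key hs ht hA'.2
  · refine (((h.mono ht.1 hs.2).gronwall hNc hu huU hv ht.1 hts hs.2).2).trans ?_
    exact key ht hs (by linarith)

end

/-- Approximating controls `z k` for `u` and the corresponding solutions `x k`; the control `z k`
reaches `u T` at the times `θ k j`, where the solutions converge to `y j`, and the sum of time and
arc length converges to `a j`. -/
structure IsExcursionSequence (S : ImpulsiveSystem n m l) (T : ℝ) (x₀ : EuclideanSpace ℝ (Fin n))
    (u : ℝ → EuclideanSpace ℝ (Fin m)) (v : ℝ → EuclideanSpace ℝ (Fin l))
    (w : EuclideanSpace ℝ (Fin m)) (z : ℕ → ℝ → EuclideanSpace ℝ (Fin m))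
    (x : ℕ → ℝ → EuclideanSpace ℝ (Fin n)) (X : ℝ → EuclideanSpace ℝ (Fin n)) (θ : ℕ → ℕ → ℝ)
    (y : ℕ → EuclideanSpace ℝ (Fin n)) (a : ℕ → ℝ) : Prop where
  lipschitz : ∀ k, ∃ K, LipschitzOnWith K (z k) (Icc 0 T)
  mem : ∀ k, ∀ t ∈ Icc 0 T, z k t ∈ S.U
  control_zero : ∀ k, z k 0 = u 0
  tendsto_control : ∀ t ∈ Icc 0 T, Tendsto (fun k => z k t) atTop (𝓝 (u t))
  arcLength_le : ∀ t ∈ Ico 0 T, ∃ W : ℝ, ∀ k, arcLength (z k) t ≤ W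
  exists_finset : ∃ A, ∀ τ < T, ∃ G : Finset ℝ, (∀ r ∈ G, r ∈ Ico 0 T) ∧
    ∀ᶠ k in atTop, ∀ s ∈ Icc 0 τ, ∃ r ∈ G, |arcLength (z k) s - arcLength (z k) r| ≤ A
  solution : ∀ k, S.IsLipschitzSolution 0 T (z k) v (x k)
  state_zero : ∀ k, x k 0 = x₀
  tendsto_state : ∀ t ∈ Ico 0 T, Tendsto (fun k => x k t) atTop (𝓝 (X t))
  excursion : ∀ j, ∀ᶠ k in atTop, excursionTime T j < θ k j ∧ θ k j ≤ excursionTime T (j + 1) ∧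
    z k (θ k j) = u T
  arcLength_excursion : ∀ j, ∀ᶠ k in atTop,
    arcLength (z k) (θ k j) + ‖w - u T‖ ≤ arcLength (z k) (θ k (j + 1))
  tendsto_excursion_state : ∀ j, Tendsto (fun k => x k (θ k j)) atTop (𝓝 (y j))
  tendsto_excursion_arcLength : ∀ j,
    Tendsto (fun k => θ k j + arcLength (z k) (θ k j)) atTop (𝓝 (a j))

/-- One extraction handles the trajectories at countably many times together with the states and
lengths at all excursions. The remaining times are continuity points of `Ψ`, where a trajectory
hardly moves from a nearby rational time, uniformly in large `k`. -/
theorem StandingAssumptions.exists_isExcursionSequence (hS : S.StandingAssumptions)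
    (hW : WhitneyProperty S.U) {T : ℝ} (hT : 0 < T) (x₀ : EuclideanSpace ℝ (Fin n))
    {u : ℝ → EuclideanSpace ℝ (Fin m)} {v : ℝ → EuclideanSpace ℝ (Fin l)}
    (hu : IsBVlocControl S.U T u) (hv : IsL1Control S.V T v) {w : EuclideanSpace ℝ (Fin m)}
    (hw : w ∈ S.U) :
    ∃ z x X θ y a, S.IsExcursionSequence T x₀ u v w z x X θ y a := by
  classical
  obtain ⟨C, hC1, hC⟩ := hW.exists_lipschitz_path
  obtain ⟨D, hD⟩ : ∃ D, ∀ a ∈ S.U, ∀ b ∈ S.U, ‖a - b‖ ≤ D := by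
    obtain ⟨r, hr⟩ := hS.isCompact_U.isBounded.exists_norm_le
    exact ⟨r + r, fun a ha b hb => norm_sub_le_of_le (hr a ha) (hr b hb)⟩
  have hD0 : 0 ≤ D := (norm_nonneg _).trans (hD _ hw _ hw)
  have hC0 : (0 : ℝ) ≤ C := C.coe_nonneg
  set B : ℝ := 3 * C * D with hB
  have hB0 : 0 ≤ B := by positivity
  set Ψ := majorant C D T u with hΨdef
  have hΨ : MonotoneOn Ψ (Ico 0 T) := monotoneOn_majorant hC0 hD0 hT hu.2
  -- Here `1 ≤ C` is needed: `Ψ` must dominate the increments of `u` as well as those of its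
  -- interpolations.
  have hΨu : ∀ s t, 0 ≤ s → s ≤ t → t < T → ‖u t - u s‖ ≤ Ψ t - Ψ s := by
    intro s t hs hst ht
    have ht' : t ∈ Ico 0 T := ⟨hs.trans hst, ht⟩
    have h1 := norm_sub_le_arcLength_sub (hu.2 t ht') hs hst
    have h2 : (⌈T / (T - s)⌉ : ℝ) ≤ ⌈T / (T - t)⌉ := by
      exact_mod_cast Int.ceil_mono (monotoneOn_div_sub hT ⟨hs, hst.trans_lt ht⟩ ht' hst)
    have h3 : 3 * C * D * (⌈T / (T - s)⌉ : ℝ) ≤ 3 * C * D * ⌈T / (T - t)⌉ := by gcongr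
    have h4 : 1 * (arcLength u t - arcLength u s) ≤ C * (arcLength u t - arcLength u s) := by
      gcongr
      · exact (norm_nonneg _).trans h1
      · exact_mod_cast hC1
    simp only [hΨdef, majorant]
    linarith
  set disc : Set ℝ := {t | t ∈ Ico 0 T ∧ ¬ContinuousWithinAt Ψ (Ico 0 T) t}
  set E : Set ℝ := disc ∪ (range (excursionTime T) ∪ (range ((↑) : ℚ → ℝ) ∩ Ico 0 T)) with hE
  have hEc : E.Countable := by
    refine Countable.union ?_ ((countable_range _).union
      ((countable_range _).mono inter_subset_left))
    exact hΨ.countable_not_continuousWithinAt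
  have hET : E ⊆ Ico 0 T := by
    rintro t (ht | ⟨j, rfl⟩ | ht)
    · exact ht.1
    · exact Ioo_subset_Ico_self (excursionTime_mem_Ioo hT j)
    · exact ht.2
  have h0E : (0 : ℝ) ∈ E := Or.inr (Or.inr ⟨⟨0, by simp⟩, le_rfl, hT⟩)
  have hdc : ∀ t ∈ Ico 0 T, t ∉ E → t ∈ Ioo 0 T ∧ ContinuousWithinAt Ψ (Ico 0 T) t := by
    intro t ht htE
    refine ⟨⟨lt_of_le_of_ne ht.1 fun h => htE (h ▸ h0E), ht.2⟩, ?_⟩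
    by_contra h
    exact htE (Or.inl ⟨ht, h⟩)
  obtain ⟨P, hPT, hP0, hPTm, hPE, hdense⟩ :=
    exists_finset_exhaustion hT hEc (hET.trans Ico_subset_Icc_self)
  have hzex : ∀ k, ∃ z, IsApproxControl S.U T u Ψ B w (P k) z := fun k =>
    exists_isApproxControl hT hC hD hu.1 hu.2 hw (hPT k) (hP0 k) (hPTm k)
  choose z hz using hzex
  have hxex : ∀ k, ∃ x, x 0 = x₀ ∧ S.IsLipschitzSolution 0 T (z k) v x := fun k => by
    obtain ⟨K, hK⟩ := (hz k).lipschitz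
    exact hS.exists_isLipschitzSolution hT hK (hz k).mem hv le_rfl hT.le le_rfl x₀
  choose x hx0 hx using hxex
  -- While one of the two excursion times is missing from the grid, `0` is used as default, so that
  -- all the sequences stay bounded for the extraction. For fixed `j` this happens for finitely many
  -- `k` only.
  have hθex : ∀ k j, ∃ θ, θ ∈ Icc 0 (excursionTime T (j + 1)) ∧
      (excursionTime T j ∈ P k → excursionTime T (j + 1) ∈ P k →
        excursionTime T j < θ ∧ z k θ = u T ∧ ∃ θ', θ < θ' ∧ θ' ≤ excursionTime T (j + 1) ∧
          z k θ' = w) := by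
    intro k j
    have hpos := excursionTime_mem_Ioo hT
    by_cases h : excursionTime T j ∈ P k ∧ excursionTime T (j + 1) ∈ P k
    · obtain ⟨θ, θ', h1, h2, h3, h4, h5, h6⟩ := (hz k).excursion j h.1
      have h7 : θ' ≤ excursionTime T (j + 1) :=
        (h4 _ h.2).resolve_left (strictMono_excursionTime hT j.lt_succ_self).not_ge
      exact ⟨θ, ⟨((hpos j).1.trans h1).le, h2.le.trans h7⟩, fun _ _ => ⟨h1, h5, θ', h2, h7, h6⟩⟩
    · exact ⟨0, ⟨le_rfl, (hpos _).1.le⟩, fun h1 h2 => absurd ⟨h1, h2⟩ h⟩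
  choose θ hθm hθ using hθex
  obtain ⟨N, c, hNc⟩ := hS.exists_growthBound
  have hN := hNc.1
  have hc := hNc.2.1
  have harc : ∀ k, ∀ s t, 0 ≤ s → s ≤ t → t < T → arcLength (z k) s ≤ Ψ t - Ψ 0 + B :=
    fun k s t hs hst ht => ((hz k).arcLength_le hs hst ht.le).trans
      ((hz k).arcLength_le_majorant hΨ (hP0 k) ⟨hs.trans hst, ht⟩)
  have hxb : ∀ t < T, ∃ R, 0 ≤ R ∧ ∀ k, ∀ s ∈ Icc 0 t, ‖x k s‖ ≤ R := by
    intro t ht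
    refine ⟨Real.exp (N * (T + (Ψ t - Ψ 0 + B))) * (c + ‖x₀‖), by positivity, fun k s hs => ?_⟩
    obtain ⟨K, hK⟩ := (hz k).lipschitz
    have h1 := (hx k).add_norm_le_of_abs_arcLength_sub_le hNc hK (hz k).mem hv.2
      (s := 0) (t := s) (A := Ψ t - Ψ 0 + B) ⟨le_rfl, hT.le⟩ ⟨hs.1, hs.2.trans ht.le⟩ (by
        rw [arcLength_zero, sub_zero, abs_of_nonneg arcLength_nonneg]
        exact harc k s t hs.1 hs.2 ht)
    rw [hx0 k] at h1
    linarith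
  have : Countable (E × ℕ) := by
    have := hEc.to_subtype
    infer_instance
  obtain ⟨φ, hφ, hlim⟩ := exists_strictMono_forall_tendsto (ι := E × ℕ)
    (f := fun i k => (x k i.1, x k (θ k i.2), θ k i.2 + arcLength (z k) (θ k i.2))) (by
      rintro ⟨⟨t, ht⟩, j⟩
      obtain ⟨R, hR0, hR⟩ := hxb t (hET ht).2
      obtain ⟨R', hR'0, hR'⟩ := hxb _ (excursionTime_mem_Ioo hT (j + 1)).2
      refine ((Metric.isBounded_closedBall (x := (0 : EuclideanSpace ℝ (Fin n))) (r := R)).prod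
        ((Metric.isBounded_closedBall (x := (0 : EuclideanSpace ℝ (Fin n))) (r := R')).prod
        (Metric.isBounded_Icc 0 (T + (Ψ (excursionTime T (j + 1)) - Ψ 0 + B))))).subset ?_
      rintro _ ⟨k, rfl⟩
      have hj := hθm k j
      refine ⟨by simpa using hR k t ⟨(hET ht).1, le_rfl⟩, by simpa using hR' k _ hj,
        add_nonneg hj.1 arcLength_nonneg, add_le_add ?_ ?_⟩
      · exact hj.2.trans (excursionTime_mem_Ioo hT (j + 1)).2.le
      · exact harc k _ _ hj.1 hj.2 (excursionTime_mem_Ioo hT (j + 1)).2)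
  have hlimE : ∀ t ∈ E, ∃ a, Tendsto (fun k => x (φ k) t) atTop (𝓝 a) := fun t ht => by
    obtain ⟨a, ha⟩ := hlim (⟨t, ht⟩, 0)
    exact ⟨a.1, (continuous_fst.tendsto a).comp ha⟩
  have hlimθ : ∀ j, ∃ y, Tendsto (fun k => x (φ k) (θ (φ k) j)) atTop (𝓝 y) := fun j => by
    obtain ⟨a, ha⟩ := hlim (⟨0, h0E⟩, j)
    exact ⟨a.2.1, ((continuous_fst.comp continuous_snd).tendsto a).comp ha⟩
  have hlima : ∀ j, ∃ b, Tendsto (fun k => θ (φ k) j + arcLength (z (φ k)) (θ (φ k) j)) atTop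
      (𝓝 b) := fun j => by
    obtain ⟨a, ha⟩ := hlim (⟨0, h0E⟩, j)
    exact ⟨a.2.2, ((continuous_snd.comp continuous_snd).tendsto a).comp ha⟩
  have hlimX : ∀ t, ∃ a, t ∈ Ico 0 T → Tendsto (fun k => x (φ k) t) atTop (𝓝 a) := by
    intro t
    by_cases ht : t ∈ Ico 0 T
    swap
    · exact ⟨0, fun h => absurd h ht⟩
    suffices h : CauchySeq fun k => x (φ k) t by
      obtain ⟨a, ha⟩ := cauchySeq_tendsto_of_complete h
      exact ⟨a, fun _ => ha⟩
    by_cases htE : t ∈ E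
    · exact (hlimE t htE).choose_spec.cauchySeq
    obtain ⟨ht', hcont⟩ := hdc t ht htE
    obtain ⟨R, hR0, hR⟩ := hxb t ht.2
    refine cauchySeq_of_forall_approx fun ε hε => ?_
    set L := (c + R) * N + 1 with hL
    have hLpos : 0 < L := by positivity
    set η := ε / (2 * L) with hη
    have hηpos : 0 < η := by positivity
    obtain ⟨s₀, s₁, h0, h1, h2, h3, hev⟩ := eventually_arcLength_sub_le hz hdense ht' hcont hηpos
    -- The rational is close enough to `t` that elapsed time and elapsed length are each at most
    -- `η`, whence the factor `2` in the choice of `η`.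
    obtain ⟨q, hq1, hq2⟩ := exists_rat_btwn (max_lt h1 (sub_lt_self t hηpos))
    have hq1' := (max_lt_iff.1 hq1)
    have hqE : (q : ℝ) ∈ E := Or.inr (Or.inr ⟨mem_range_self q, by linarith, by linarith [ht.2]⟩)
    have hq0 : (0 : ℝ) ≤ q := (hET hqE).1
    refine ⟨fun k => x (φ k) q, (hlimE q hqE).choose_spec.cauchySeq, ?_⟩
    filter_upwards [hφ.tendsto_atTop.eventually hev] with k hk
    obtain ⟨K, hK⟩ := (hz (φ k)).lipschitz
    have e1 := ((hx (φ k)).mono hq0 ht.2.le).norm_sub_le hNc hK (hz (φ k)).mem hv.2 hq0 hq2.le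
      ht.2.le (R := R) fun r hr => hR _ r ⟨hq0.trans hr.1, hr.2⟩
    have e2 := (hz (φ k)).arcLength_le ht.1 h2.le h3.le
    have e3 := (hz (φ k)).arcLength_le h0 hq1'.1.le (hET hqE).2.le
    rw [dist_eq_norm]
    refine e1.trans ?_
    rw [gauge, gauge, ← mul_sub, ← mul_assoc]
    have e4 : t + arcLength (z (φ k)) t - (q + arcLength (z (φ k)) q) ≤ 2 * η := by linarith
    calc (c + R) * N * (t + arcLength (z (φ k)) t - (q + arcLength (z (φ k)) q))
        ≤ (c + R) * N * (2 * η) := by gcongr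
      _ ≤ L * (2 * η) := by gcongr; linarith
      _ = ε := by rw [hη]; field_simp
  choose y hy using hlimθ
  choose b hb using hlima
  choose X hX using hlimX
  have hτE : ∀ j, ∀ᶠ k in atTop, excursionTime T j ∈ P (φ k) := fun j =>
    hφ.tendsto_atTop.eventually (hPE _ (Or.inr (Or.inl (mem_range_self j))))
  refine ⟨fun k => z (φ k), fun k => x (φ k), X, fun k => θ (φ k), y, b,
    fun k => (hz _).lipschitz, fun k => (hz _).mem, fun k => (hz _).eq_of_mem 0 (hP0 _), ?_, ?_,
    ⟨B + 1, fun τ hτ => ?_⟩, fun k => hx _, fun k => hx0 _, fun t ht => hX t ht, fun j => ?_,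
    fun j => ?_, hy, hb⟩
  · intro t ht
    refine (tendsto_of_isApproxControl hz hdense hΨ hΨu ?_).comp hφ.tendsto_atTop
    rcases ht.2.eq_or_lt with rfl | htT
    · exact Or.inl (Eventually.of_forall hPTm)
    by_cases htE : t ∈ E
    · exact Or.inl (hPE t htE)
    · exact Or.inr (hdc t ⟨ht.1, htT⟩ htE)
  · exact fun t ht => ⟨_, fun k => harc _ t t ht.1 le_rfl ht.2⟩
  · obtain ⟨G, hG, hev⟩ := exists_finset_arcLength_sub_le hz hdense hΨ hB0 hτ
    exact ⟨G, hG, hφ.tendsto_atTop.eventually hev⟩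
  · filter_upwards [hτE j, hτE (j + 1)] with k h1 h2
    obtain ⟨h3, h4, _⟩ := hθ (φ k) j h1 h2
    exact ⟨h3, (hθm _ _).2, h4⟩
  · filter_upwards [hτE j, hτE (j + 1), hτE (j + 2)] with k h1 h2 h3
    obtain ⟨_, h4, θ', h5, h6, h7⟩ := hθ (φ k) j h1 h2
    obtain ⟨h8, _⟩ := hθ (φ k) (j + 1) h2 h3
    have hT' := (excursionTime_mem_Ioo hT (j + 1)).2
    have e1 := norm_sub_le_arcLength_sub ((hz (φ k)).boundedVariationOn (h6.trans hT'.le))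
      (hθm (φ k) j).1 h5.le
    have e2 := (hz (φ k)).arcLength_le ((hθm (φ k) j).1.trans h5.le) (h6.trans h8.le)
      ((hθm (φ k) (j + 1)).2.trans (excursionTime_mem_Ioo hT _).2.le)
    rw [h4, h7] at e1
    linarith

end ImpulsiveSystem

/-! ### Limit solutions on `[0,T[` and up to `T` -/

theorem eq_arcLength_of_eqOn {F : Type*} [PseudoEMetricSpace F] {u u' : ℝ → F} {t : ℝ}
    (h : EqOn u u' (Icc 0 t)) : arcLength u t = arcLength u' t := by
  rw [arcLength, arcLength, eVariationOn.congr h]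

namespace ImpulsiveSystem

variable {n m l : ℕ} {S : ImpulsiveSystem n m l} {T : ℝ} {x₀ : EuclideanSpace ℝ (Fin n)}
  {u : ℝ → EuclideanSpace ℝ (Fin m)} {v : ℝ → EuclideanSpace ℝ (Fin l)}
  {w : EuclideanSpace ℝ (Fin m)} {z : ℕ → ℝ → EuclideanSpace ℝ (Fin m)}
  {x : ℕ → ℝ → EuclideanSpace ℝ (Fin n)}

theorem isApproximation_of_lipschitz (hT : 0 < T)
    (hlip : ∀ k, ∃ K, LipschitzOnWith K (z k) (Icc 0 T)) (hmem : ∀ k, ∀ t ∈ Icc 0 T, z k t ∈ S.U)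
    (hz0 : ∀ k, z k 0 = u 0) (hzu : ∀ t ∈ Icc 0 T, Tendsto (fun k => z k t) atTop (𝓝 (u t)))
    (harc : ∀ t ∈ Ico 0 T, ∃ W : ℝ, ∀ k, arcLength (z k) t ≤ W)
    (hx : ∀ k, S.IsLipschitzSolution 0 T (z k) v (x k)) (hx0 : ∀ k, x k 0 = x₀) :
    S.IsApproximation T x₀ u v z x := by
  refine ⟨fun k => ⟨⟨hmem k, ?_⟩, hz0 k⟩, hzu, fun t ht => ?_, fun k => ?_⟩
  · obtain ⟨K, hK⟩ := hlip k
    exact LipschitzOnWith.absolutelyContinuousOnInterval (by rwa [uIcc_of_le hT.le])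
  · obtain ⟨W, hW⟩ := harc t ⟨ht.1.le, ht.2⟩
    refine ⟨W.toNNReal, fun k => ?_⟩
    obtain ⟨K, hK⟩ := hlip k
    rw [← ofReal_arcLength (hK.mono (Icc_subset_Icc_right ht.2.le)).boundedVariationOn_Icc]
    exact ENNReal.ofReal_le_ofReal (hW k)
  · rw [← hx0 k]
    exact (hx k).isCaratheodorySolution hT.le

/-- Freezing the control at time `Θ`. -/
theorem StandingAssumptions.exists_solution_stopped (hS : S.StandingAssumptions) (hT : 0 < T)
    (hv : IsL1Control S.V T v) {z : ℝ → EuclideanSpace ℝ (Fin m)}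
    {x : ℝ → EuclideanSpace ℝ (Fin n)} {K : ℝ≥0} (hz : LipschitzOnWith K z (Icc 0 T))
    (hzU : ∀ t ∈ Icc 0 T, z t ∈ S.U) (hx : S.IsLipschitzSolution 0 T z v x) {Θ : ℝ}
    (hΘ : Θ ∈ Icc 0 T) :
    LipschitzOnWith K (fun t => z (min t Θ)) (Icc 0 T) ∧ (∀ t ∈ Icc 0 T, z (min t Θ) ∈ S.U) ∧
    ∃ x', S.IsLipschitzSolution 0 T (fun t => z (min t Θ)) v x' ∧ ∀ t ≤ Θ, x' t = x t := by
  have hmin : ∀ t ∈ Icc 0 T, min t Θ ∈ Icc 0 T := fun t ht =>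
    ⟨le_min ht.1 hΘ.1, (min_le_left _ _).trans ht.2⟩
  have hlip : LipschitzOnWith K (fun t => z (min t Θ)) (Icc 0 T) := by
    have h1 : LipschitzWith 1 fun t : ℝ => min t Θ := LipschitzWith.id.min_const Θ
    have := hz.comp (h1.lipschitzOnWith (s := Icc 0 T)) hmin
    rwa [mul_one] at this
  have hmem : ∀ t ∈ Icc 0 T, z (min t Θ) ∈ S.U := fun t ht => hzU _ (hmin t ht)
  obtain ⟨y, hy0, hy⟩ := hS.exists_isLipschitzSolution hT hlip hmem hv hΘ.1 hΘ.2 le_rfl (x Θ)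
  have hx' : S.IsLipschitzSolution 0 Θ (fun t => z (min t Θ)) v x :=
    (hx.mono le_rfl hΘ.2).congr_control fun t ht => by simp only [min_eq_left ht.2.le]
  exact ⟨hlip, hmem, _, hx'.glue hy hy0.symm, fun t ht => if_pos ht⟩

namespace IsExcursionSequence

variable {X : ℝ → EuclideanSpace ℝ (Fin n)} {θ : ℕ → ℕ → ℝ} {y : ℕ → EuclideanSpace ℝ (Fin n)}
  {a : ℕ → ℝ}

theorem isBVlocSLimitSolutionIco (h : S.IsExcursionSequence T x₀ u v w z x X θ y a)
    (hS : S.StandingAssumptions) (hT : 0 < T) (hv : IsL1Control S.V T v)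
    {X' : ℝ → EuclideanSpace ℝ (Fin n)} (hX : EqOn X X' (Ico 0 T)) :
    S.IsBVlocSLimitSolutionIco T x₀ u v X' := by
  refine ⟨z, x, isApproximation_of_lipschitz hT h.lipschitz h.mem h.control_zero
    h.tendsto_control h.arcLength_le h.solution h.state_zero, fun t ht => ?_,
    fun t ht => hX ht ▸ h.tendsto_state t ht⟩
  obtain ⟨N, c, hNc⟩ := hS.exists_growthBound
  have hc := hNc.2.1
  obtain ⟨W, hW⟩ := h.arcLength_le t ht
  refine ⟨Real.exp (N * (T + W)) * (c + ‖x₀‖), fun k s hs => ?_⟩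
  obtain ⟨K, hK⟩ := h.lipschitz k
  have h1 := (h.solution k).add_norm_le_of_abs_arcLength_sub_le hNc hK (h.mem k) hv.2
    (s := 0) (t := s) (A := W) ⟨le_rfl, hT.le⟩ ⟨hs.1, hs.2.trans ht.2.le⟩ (by
      rw [arcLength_zero, sub_zero, abs_of_nonneg arcLength_nonneg]
      refine (arcLength_mono ?_ hs.1 hs.2).trans (hW k)
      exact (hK.mono (Icc_subset_Icc_right ht.2.le)).boundedVariationOn_Icc)
  rw [h.state_zero k] at h1
  linarith

/-- The point is that `R` does not depend on `τ`. At finitely many representative times the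
trajectories are close to the bounded limit, and any other time is within a fixed length `A` of one
of them, so Grönwall loses only a fixed factor. -/
theorem exists_eventually_norm_le (h : S.IsExcursionSequence T x₀ u v w z x X θ y a)
    (hS : S.StandingAssumptions) (hv : IsL1Control S.V T v)
    (hX : Bornology.IsBounded (X '' Ico 0 T)) :
    ∃ R, 0 ≤ R ∧ ∀ τ < T, ∀ᶠ k in atTop, ∀ s ∈ Icc 0 τ, ‖x k s‖ ≤ R := by
  obtain ⟨N, c, hNc⟩ := hS.exists_growthBound
  have hc := hNc.2.1
  obtain ⟨B₀, hB₀⟩ := hX.exists_norm_le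
  obtain ⟨A, hA⟩ := h.exists_finset
  refine ⟨Real.exp (N * (T + A)) * (c + (|B₀| + 1)), by positivity, fun τ hτ => ?_⟩
  obtain ⟨G, hG, hev⟩ := hA τ hτ
  have hev' : ∀ᶠ k in atTop, ∀ r ∈ G, ‖x k r‖ ≤ |B₀| + 1 := by
    rw [eventually_all_finset]
    intro r hr
    have h1 := (h.tendsto_state r (hG r hr)).norm
    have h2 : ‖X r‖ < |B₀| + 1 :=
      ((hB₀ _ (mem_image_of_mem X (hG r hr))).trans (le_abs_self _)).trans_lt (lt_add_one _)
    exact (h1.eventually_lt_const h2).mono fun k hk => hk.le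
  filter_upwards [hev, hev'] with k hk hk' s hs
  obtain ⟨r, hr, hle⟩ := hk s hs
  obtain ⟨K, hK⟩ := h.lipschitz k
  have h1 := (h.solution k).add_norm_le_of_abs_arcLength_sub_le hNc hK (h.mem k) hv.2
    (Ico_subset_Icc_self (hG r hr)) ⟨hs.1, hs.2.trans hτ.le⟩ hle
  have h2 := hk' r hr
  calc ‖x k s‖ ≤ c + ‖x k s‖ := by linarith
    _ ≤ _ := h1
    _ ≤ _ := by gcongr

theorem le_excursion_arcLength (h : S.IsExcursionSequence T x₀ u v w z x X θ y a) (j : ℕ) :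
    excursionTime T j ≤ a j := by
  refine ge_of_tendsto (h.tendsto_excursion_arcLength j) ?_
  filter_upwards [h.excursion j] with k hk
  exact hk.1.le.trans (le_add_of_nonneg_right arcLength_nonneg)

/-- Between two consecutive visits to `u T` the control has visited `w`. The resulting linear growth
is what makes the sequence in the final-time condition diverge when `w ≠ u T`. -/
theorem excursion_arcLength_add_le (h : S.IsExcursionSequence T x₀ u v w z x X θ y a) (j : ℕ) :
    a j + ‖w - u T‖ ≤ a (j + 1) := by
  refine le_of_tendsto_of_tendsto ((h.tendsto_excursion_arcLength j).add_const _)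
    (h.tendsto_excursion_arcLength (j + 1)) ?_
  filter_upwards [h.excursion j, h.excursion (j + 1), h.arcLength_excursion j] with k h1 h2 h3
  linarith [h1.2.1, h2.1]

theorem excursion_arcLength_add_mul_le (h : S.IsExcursionSequence T x₀ u v w z x X θ y a)
    (i j : ℕ) : a i + j * ‖w - u T‖ ≤ a (i + j) := by
  induction j with
  | zero => simp
  | succ j ih =>
    have := h.excursion_arcLength_add_le (i + j)
    rw [← add_assoc]
    push_cast
    linarith

/-- The time `τ` with prescribed value of time plus arc length. -/
theorem exists_time_of_le {z : ℝ → EuclideanSpace ℝ (Fin m)} {K : ℝ≥0}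
    (hz : LipschitzOnWith K z (Icc 0 T)) {t s : ℝ} (ht : t ∈ Icc 0 T) (hs : 0 ≤ s)
    (hst : s ≤ t + arcLength z t) : ∃ τ ∈ Icc 0 t, τ + arcLength z τ = s := by
  have hcont : ContinuousOn (fun r => r + arcLength z r) (Icc 0 t) :=
    continuousOn_id.add (hz.arcLength.continuousOn.mono (Icc_subset_Icc_right ht.2))
  have h := intermediate_value_Icc ht.1 hcont
  simp only [arcLength_zero, add_zero] at h
  exact h ⟨hs, hst⟩

/-- The `i`-th new control follows an old one to its excursion number `J i` and stays at `u T`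
afterwards, so the state at `T` is close to the cluster point `ξ` of the excursion states. Its
earlier visits to `u T`, those numbered `J r` with `r ≤ i`, also find the state near `ξ`, at nearly
prescribed values of time plus length. -/
theorem exists_isBVlocSLimitSolutionIcc (h : S.IsExcursionSequence T x₀ u v w z x X θ y a)
    (hS : S.StandingAssumptions) (hT : 0 < T) (hv : IsL1Control S.V T v) (hw : w ≠ u T)
    (hX : Bornology.IsBounded (X '' Ico 0 T)) :
    ∃ ξ, S.IsBVlocSLimitSolutionIcc T x₀ u v (Function.update X T ξ) := by
  obtain ⟨N, c, hNc⟩ := hS.exists_growthBound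
  have hN := hNc.1
  have hc := hNc.2.1
  obtain ⟨R, hR0, hR⟩ := h.exists_eventually_norm_le hS hv hX
  have hτm := excursionTime_mem_Ioo hT
  have hτlt := strictMono_excursionTime hT
  set e := ‖w - u T‖ with he
  have hepos : 0 < e := norm_pos_iff.2 (sub_ne_zero.2 hw)
  have hyR : ∀ j, y j ∈ Metric.closedBall (0 : EuclideanSpace ℝ (Fin n)) R := by
    intro j
    rw [mem_closedBall_zero_iff]
    refine le_of_tendsto (h.tendsto_excursion_state j).norm ?_
    filter_upwards [h.excursion j, hR _ (hτm (j + 1)).2] with k h1 h2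
    exact h2 _ ⟨((hτm j).1.trans h1.1).le, h1.2.1⟩
  obtain ⟨ξ, _, ψ, hψ, hξ⟩ := (isCompact_closedBall _ R).tendsto_subseq hyR
  -- A further subsequence imposes the explicit rate `1 / (i + 1)`, so that the final error function
  -- can be written in closed form.
  obtain ⟨χ, hχ, hχξ⟩ := extraction_forall_of_eventually
    (P := fun i k => ‖y (ψ k) - ξ‖ < 1 / ((i : ℝ) + 1)) fun i => by
      have := Metric.tendsto_nhds.1 hξ (1 / ((i : ℝ) + 1)) (by positivity)
      filter_upwards [this] with k hk
      rwa [← dist_eq_norm]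
  set J : ℕ → ℕ := fun i => ψ (χ i) with hJ
  have hJm : StrictMono J := hψ.comp hχ
  have hJle : ∀ i, i ≤ J i := hJm.id_le
  -- The bound `e₀ ≤ a 0` makes the values `s i` below nonnegative.
  set e₀ := min e (a 0) with he₀
  have ha0 : 0 < a 0 := (hτm 0).1.trans_le (h.le_excursion_arcLength 0)
  have he₀pos : 0 < e₀ := lt_min hepos ha0
  set η : ℕ → ℝ := fun i => e₀ / ((i : ℝ) + 1) with hη
  have hηpos : ∀ i, 0 < η i := fun i => by positivity
  have hηle : ∀ i, η i ≤ e₀ := fun i =>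
    div_le_self he₀pos.le (le_add_of_nonneg_left i.cast_nonneg)
  have hηanti : ∀ i, η (i + 1) ≤ η i := fun i => by
    simp only [hη]
    push_cast
    gcongr
    linarith
  have haJ : ∀ i, a 0 + i * e ≤ a (J i) := fun i => by
    have h1 := h.excursion_arcLength_add_mul_le 0 (J i)
    rw [zero_add] at h1
    have h2 : (i : ℝ) * e ≤ J i * e := by
      gcongr
      exact hJle i
    linarith
  have hagap : ∀ i, a (J i) + e ≤ a (J (i + 1)) := fun i => by
    obtain ⟨d, hd⟩ := Nat.exists_eq_add_of_lt (hJm i.lt_succ_self)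
    have h1 := h.excursion_arcLength_add_mul_le (J i) (d + 1)
    rw [← add_assoc, ← hd] at h1
    push_cast at h1
    have h2 : 0 ≤ (d : ℝ) * e := by positivity
    linarith
  -- Time plus length at the excursion only converges to `a (J i)`, whereas the final-time condition
  -- asks for an exact value. Aiming lower by `η i` guarantees that the value is attained before the
  -- excursion, by continuity.
  set s : ℕ → ℝ := fun i => a (J i) - η i with hs
  have hs0 : ∀ i, 0 ≤ s i := fun i => by
    have h1 := haJ i
    have h2 : 0 ≤ (i : ℝ) * e := by positivity
    have h3 := hηle i
    have h4 : e₀ ≤ a 0 := min_le_right _ _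
    simp only [hs]
    linarith
  have hsm : StrictMono s := strictMono_nat_of_lt_succ fun i => by
    have h1 := hagap i
    have h2 := hηanti i
    simp only [hs]
    linarith
  have hst : Tendsto s atTop atTop := by
    refine tendsto_atTop_mono (f := fun i : ℕ => (i : ℝ) * e - e₀ + a 0) (fun i => ?_) ?_
    · have h1 := haJ i
      have h3 := hηle i
      simp only [hs]
      linarith
    · exact tendsto_atTop_add_const_right _ _ (tendsto_atTop_add_const_right _ _
        (tendsto_natCast_atTop_atTop.atTop_mul_const hepos))
  -- Diagonal choice: the `i`-th control must be accurate at all excursions `J r` with `r ≤ i`, so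
  -- the final-time condition can later use the identity as its threshold sequence.
  obtain ⟨κ, hκ, hsel⟩ := extraction_forall_of_eventually (P := fun i k =>
    (∀ r ∈ Finset.range (i + 1), (excursionTime T (J r) < θ k (J r) ∧
      θ k (J r) ≤ excursionTime T (J r + 1) ∧ z k (θ k (J r)) = u T) ∧
      ‖θ k (J r) + arcLength (z k) (θ k (J r)) - a (J r)‖ < η r ∧
      ‖x k (θ k (J r)) - y (J r)‖ < 1 / ((r : ℝ) + 1)) ∧
    ∀ t ∈ Icc 0 (excursionTime T (J i + 1)), ‖x k t‖ ≤ R) fun i => by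
      refine Eventually.and ?_ (hR _ (hτm _).2)
      rw [eventually_all_finset]
      intro r _
      refine (h.excursion (J r)).and (Eventually.and ?_ ?_)
      · exact Metric.tendsto_nhds.1 (h.tendsto_excursion_arcLength (J r)) _ (hηpos r)
      · have := Metric.tendsto_nhds.1 (h.tendsto_excursion_state (J r)) (1 / ((r : ℝ) + 1))
          (by positivity)
        filter_upwards [this] with k hk
        rwa [← dist_eq_norm]
  have hsel1 : ∀ i r, r ≤ i → _ := fun i r hr => (hsel i).1 r (Finset.mem_range.2 (by omega))
  set Θ : ℕ → ℝ := fun i => θ (κ i) (J i) with hΘ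
  have hΘ1 : ∀ i, excursionTime T (J i) < Θ i := fun i => (hsel1 i i le_rfl).1.1
  have hΘ2 : ∀ i, Θ i ≤ excursionTime T (J i + 1) := fun i => (hsel1 i i le_rfl).1.2.1
  have hΘ3 : ∀ i, z (κ i) (Θ i) = u T := fun i => (hsel1 i i le_rfl).1.2.2
  have hΘm : ∀ i, Θ i ∈ Ioo 0 T := fun i =>
    ⟨(hτm _).1.trans (hΘ1 i), (hΘ2 i).trans_lt (hτm _).2⟩
  have hΘm' : ∀ i, Θ i ∈ Icc 0 T := fun i => Ioo_subset_Icc_self (hΘm i)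
  have hrΘ : ∀ i r, r ≤ i → 0 ≤ θ (κ i) (J r) ∧ θ (κ i) (J r) ≤ Θ i := by
    intro i r hr
    refine ⟨((hτm _).1.trans (hsel1 i r hr).1.1).le, ?_⟩
    rcases hr.eq_or_lt with rfl | hr'
    · exact le_rfl
    · exact ((hsel1 i r hr).1.2.1.trans (hτlt.monotone (hJm hr'))).trans (hΘ1 i).le
  choose K hK using fun i => h.lipschitz (κ i)
  have hfrozen := fun i => hS.exists_solution_stopped hT hv (hK i) (h.mem (κ i)) (h.solution (κ i))
    (hΘm' i)
  choose hzlip hzmem x' hx' hx'eq using hfrozen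
  set z' : ℕ → ℝ → EuclideanSpace ℝ (Fin m) := fun i t => z (κ i) (min t (Θ i)) with hz'
  have hz'eq : ∀ i t, t ≤ Θ i → z' i t = z (κ i) t := fun i t ht => by
    simp only [hz', min_eq_left ht]
  have hz'T : ∀ i t, Θ i ≤ t → z' i t = u T := fun i t ht => by
    simp only [hz', min_eq_right ht, hΘ3]
  have harc' : ∀ i t, t ≤ Θ i → arcLength (z' i) t = arcLength (z (κ i)) t := fun i t ht =>
    eq_arcLength_of_eqOn fun r hr => hz'eq i r (hr.2.trans ht)
  have harcT : ∀ i t, Θ i ≤ t → t ≤ T → arcLength (z' i) t = arcLength (z' i) (Θ i) := by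
    intro i t ht htT
    have hb := ((hzlip i).mono (Icc_subset_Icc_right htT)).boundedVariationOn_Icc
    rw [← arcLength_add hb (hΘm i).1.le ht, eVariationOn.constant_on, ENNReal.toReal_zero, add_zero]
    rintro _ ⟨p, hp, rfl⟩ _ ⟨q, hq, rfl⟩
    exact (hz'T i p hp.1).trans (hz'T i q hq.1).symm
  have hbd1 : ∀ i t, 0 ≤ t → t ≤ Θ i → ‖x' i t‖ ≤ R := fun i t ht0 ht => by
    rw [hx'eq i t ht]
    exact (hsel i).2 t ⟨ht0, ht.trans (hΘ2 i)⟩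
  -- After `Θ i` the control has zero length, so only elapsed time enters Grönwall.
  set R₂ := Real.exp (N * (T + 0)) * (c + R) with hR₂
  have hbd2 : ∀ i t, Θ i ≤ t → t ≤ T → ‖x' i t‖ ≤ R₂ := fun i t ht htT => by
    have h1 := (hx' i).add_norm_le_of_abs_arcLength_sub_le hNc (hzlip i) (hzmem i) hv.2
      (hΘm' i) ⟨(hΘm i).1.le.trans ht, htT⟩ (A := 0) (by
        rw [harcT i t ht htT, sub_self, abs_zero])
    have h2 := hbd1 i (Θ i) (hΘm i).1.le le_rfl
    calc ‖x' i t‖ ≤ c + ‖x' i t‖ := by linarith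
      _ ≤ _ := h1
      _ ≤ _ := by rw [hR₂]; gcongr
  set M₂ := (c + R₂) * N * T with hM₂
  have hR₂0 : 0 ≤ R₂ := by positivity
  have hM₂0 : 0 ≤ M₂ := by positivity
  have hend : ∀ i, ‖x' i T - x' i (Θ i)‖ ≤ M₂ / ((i : ℝ) + 1) := fun i => by
    have h1 := ((hx' i).mono (hΘm i).1.le le_rfl).norm_sub_le hNc (hzlip i) (hzmem i) hv.2
      (hΘm i).1.le (hΘm i).2.le le_rfl (R := R₂) fun r hr => hbd2 i r hr.1 hr.2
    rw [gauge, gauge, harcT i T (hΘm i).2.le le_rfl, ← mul_sub, add_sub_add_right_eq_sub] at h1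
    have h2 : T - Θ i ≤ T / ((i : ℝ) + 1) := by
      have h3 := hΘ1 i
      have h4 : T / ((J i : ℝ) + 2) ≤ T / ((i : ℝ) + 1) := by
        have : (i : ℝ) ≤ J i := by exact_mod_cast hJle i
        gcongr
        linarith
      rw [excursionTime] at h3
      linarith
    refine h1.trans ?_
    calc (c + R₂) * (N * (T - Θ i)) ≤ (c + R₂) * (N * (T / ((i : ℝ) + 1))) := by gcongr
      _ = M₂ / ((i : ℝ) + 1) := by rw [hM₂]; ring
  have hξT : ∀ i, ‖x' i T - ξ‖ ≤ (M₂ + 2) / ((i : ℝ) + 1) := fun i => by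
    have h1 := hend i
    have h2 := (hsel1 i i le_rfl).2.2
    have h3 := hχξ i
    rw [← hx'eq i _ le_rfl] at h2
    have h4 : x' i T - ξ = (x' i T - x' i (Θ i)) + (x' i (Θ i) - y (J i)) + (y (J i) - ξ) := by
      abel
    rw [h4]
    refine (norm_add₃_le).trans ?_
    have h5 : (M₂ + 2) / ((i : ℝ) + 1) =
        M₂ / ((i : ℝ) + 1) + 1 / ((i : ℝ) + 1) + 1 / ((i : ℝ) + 1) := by ring
    rw [h5]
    exact add_le_add (add_le_add h1 h2.le) h3.le
  have hΘev : ∀ t < T, ∀ᶠ i in atTop, t ≤ Θ i := fun t ht => by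
    filter_upwards [((tendsto_excursionTime T).comp hJm.tendsto_atTop).eventually_const_lt ht]
      with i hi
    exact (hi.trans (hΘ1 i)).le
  refine ⟨ξ, ?_, z', x', isApproximation_of_lipschitz hT (fun i => ⟨_, hzlip i⟩) hzmem ?_ ?_ ?_
    hx' ?_, ⟨max R R₂, fun i t ht => ?_⟩, fun t ht => ?_, ?_⟩
  · refine (hX.union (Bornology.isBounded_singleton (x := ξ))).subset ?_
    rintro _ ⟨t, ht, rfl⟩
    rcases ht.2.eq_or_lt with rfl | htT
    · exact Or.inr (by simp)
    · refine Or.inl ⟨t, ⟨ht.1, htT⟩, ?_⟩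
      rw [Function.update_of_ne htT.ne]
  · intro i
    rw [hz'eq i 0 (hΘm i).1.le, h.control_zero]
  · intro t ht
    rcases ht.2.eq_or_lt with rfl | htT
    · exact tendsto_const_nhds.congr fun i => (hz'T i _ (hΘm i).2.le).symm
    · refine ((h.tendsto_control t ht).comp hκ.tendsto_atTop).congr' ?_
      filter_upwards [hΘev t htT] with i hi
      exact (hz'eq i t hi).symm
  · intro t ht
    obtain ⟨W, hW⟩ := h.arcLength_le t ht
    refine ⟨W, fun i => ?_⟩
    have hmin : min t (Θ i) ≤ t := min_le_left _ _
    have h1 : arcLength (z' i) t = arcLength (z' i) (min t (Θ i)) := by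
      rcases le_total t (Θ i) with ht' | ht'
      · rw [min_eq_left ht']
      · rw [min_eq_right ht', harcT i t ht' ht.2.le]
    rw [h1, harc' i _ (min_le_right _ _)]
    refine (arcLength_mono ?_ (le_min ht.1 (hΘm i).1.le) hmin).trans (hW (κ i))
    exact ((hK i).mono (Icc_subset_Icc_right ht.2.le)).boundedVariationOn_Icc
  · intro i
    rw [hx'eq i 0 (hΘm i).1.le, h.state_zero]
  · rcases le_total t (Θ i) with ht' | ht'
    · exact (hbd1 i t ht.1 ht').trans (le_max_left _ _)
    · exact (hbd2 i t ht' ht.2).trans (le_max_right _ _)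
  · rcases ht.2.eq_or_lt with rfl | htT
    · rw [Function.update_self, tendsto_iff_norm_sub_tendsto_zero]
      refine squeeze_zero (fun _ => norm_nonneg _) hξT ?_
      exact tendsto_const_nhds.div_atTop
        (tendsto_atTop_add_const_right _ _ tendsto_natCast_atTop_atTop)
    · rw [Function.update_of_ne htT.ne]
      refine ((h.tendsto_state t ⟨ht.1, htT⟩).comp hκ.tendsto_atTop).congr' ?_
      filter_upwards [hΘev t htT] with i hi
      exact (hx'eq i t hi).symm
  · set L := (c + R) * N with hL
    have hL0 : 0 ≤ L := by positivity
    -- Error budget: control displacement from `τ` to the excursion, state displacement over the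
    -- same piece, distance to `y (J r)` and from there to `ξ`, and distance from `ξ` to the final
    -- state.
    set M₃ := 2 * e₀ + L * (2 * e₀) + 2 + (M₂ + 2) with hM₃
    have hM₃0 : 0 < M₃ := by positivity
    refine ⟨fun r => M₃ / (r + 1), s, id, fun r hr => by positivity, ?_, ?_, hs0, hsm, hst,
      strictMono_id, fun _ => le_rfl, fun r i hri => ?_⟩
    · intro p hp q hq hpq
      have : 0 ≤ p := hp
      dsimp only
      gcongr
    · exact tendsto_const_nhds.div_atTop (tendsto_atTop_add_const_right _ _ tendsto_id)
    · have hri' : r ≤ i := le_of_lt hri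
      obtain ⟨⟨g1, g2, g3⟩, g4, g5⟩ := hsel1 i r hri'
      obtain ⟨g6, g7⟩ := hrΘ i r hri'
      set p := θ (κ i) (J r) with hp
      have hpT : p ≤ T := g7.trans (hΘm i).2.le
      have g4' := abs_lt.1 g4
      obtain ⟨τ, hτ, hτs⟩ := exists_time_of_le (hK i) (t := p) ⟨g6, hpT⟩ (hs0 r) (by
        simp only [hs]
        linarith)
      have hτΘ : τ ≤ Θ i := hτ.2.trans g7
      have hdiff : p - τ + (arcLength (z (κ i)) p - arcLength (z (κ i)) τ) ≤ 2 * η r := by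
        simp only [hs] at hτs
        linarith
      have hbv : ∀ t ≤ T, BoundedVariationOn (z (κ i)) (Icc 0 t) := fun t ht =>
        ((hK i).mono (Icc_subset_Icc_right ht)).boundedVariationOn_Icc
      have hη' : 2 * η r = 2 * e₀ / ((r : ℝ) + 1) := by simp only [hη]; ring
      have hr1 : (0 : ℝ) < (r : ℝ) + 1 := by positivity
      refine ⟨τ, hτ.1, hτΘ.trans_lt (hΘm i).2, ?_, ?_⟩
      · rw [← ofReal_arcLength ((hzlip i).mono
            (Icc_subset_Icc_right (hτΘ.trans (hΘm i).2.le))).boundedVariationOn_Icc,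
          harc' i τ hτΘ, ← ENNReal.ofReal_add hτ.1 arcLength_nonneg, hτs]
      · dsimp only
        rw [Prod.mk_sub_mk, Prod.norm_def]
        refine max_le ?_ ?_
        · dsimp only
          rw [hx'eq i τ hτΘ]
          have k1 := ((h.solution (κ i)).mono hτ.1 hpT).norm_sub_le hNc (hK i) (h.mem (κ i)) hv.2
            hτ.1 hτ.2 hpT (R := R) fun q hq => by
              rw [← hx'eq i q (hq.2.trans g7)]
              exact hbd1 i q (hτ.1.trans hq.1) (hq.2.trans g7)
          have k2 : ‖x (κ i) p - x (κ i) τ‖ ≤ L * (2 * e₀ / ((r : ℝ) + 1)) := by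
            refine k1.trans ?_
            rw [gauge, gauge, ← mul_sub, ← mul_assoc, ← hη']
            gcongr
            linarith
          have k3 := hχξ r
          have k4 : ‖x' i T - ξ‖ ≤ (M₂ + 2) / ((r : ℝ) + 1) := by
            refine (hξT i).trans ?_
            gcongr
          have k5 : x (κ i) τ - x' i T = -(x (κ i) p - x (κ i) τ) + (x (κ i) p - y (J r)) +
              ((y (J r) - ξ) + -(x' i T - ξ)) := by abel
          rw [k5]
          have k6 : M₃ / ((r : ℝ) + 1) = 2 * e₀ / ((r : ℝ) + 1) + L * (2 * e₀ / ((r : ℝ) + 1)) +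
              1 / ((r : ℝ) + 1) + 1 / ((r : ℝ) + 1) + (M₂ + 2) / ((r : ℝ) + 1) := by
            rw [hM₃]
            ring
          have k7 : 0 ≤ 2 * e₀ / ((r : ℝ) + 1) := by positivity
          have k8 := norm_add_le (-(x (κ i) p - x (κ i) τ) + (x (κ i) p - y (J r)))
            ((y (J r) - ξ) + -(x' i T - ξ))
          have k9 := norm_add_le (-(x (κ i) p - x (κ i) τ)) (x (κ i) p - y (J r))
          have k10 := norm_add_le (y (J r) - ξ) (-(x' i T - ξ))
          rw [norm_neg] at k9 k10
          rw [k6]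
          linarith
        · dsimp only
          rw [hz'eq i τ hτΘ, hz'T i T (hΘm i).2.le, ← g3, norm_sub_rev]
          refine (norm_sub_le_arcLength_sub (hbv p hpT) hτ.1 hτ.2).trans ?_
          have k1 : 2 * η r ≤ M₃ / ((r : ℝ) + 1) := by
            rw [hη']
            gcongr
            have : 0 ≤ L * (2 * e₀) := by positivity
            linarith
          linarith [hτ.2]

end IsExcursionSequence

/-- Redefining the limit at `T` leaves the assertion on `[0,T[` untouched, so one map serves both.
When `U` is a single point, `w` is an arbitrary element of `U`. -/
theorem StandingAssumptions.exists_limitSolution (hS : S.StandingAssumptions)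
    (hW : WhitneyProperty S.U) (hT : 0 < T) (x₀ : EuclideanSpace ℝ (Fin n))
    (hu : IsBVlocControl S.U T u) (hv : IsL1Control S.V T v) :
    ∃ X : ℝ → EuclideanSpace ℝ (Fin n), S.IsBVlocSLimitSolutionIco T x₀ u v X ∧
      (S.U.Nontrivial → Bornology.IsBounded (X '' Ico 0 T) →
        S.IsBVlocSLimitSolutionIcc T x₀ u v X) := by
  obtain ⟨w, hw, hwne⟩ : ∃ w ∈ S.U, S.U.Nontrivial → w ≠ u T := by
    by_cases hU : S.U.Nontrivial
    · obtain ⟨w, hw, hne⟩ := hU.exists_ne (u T)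
      exact ⟨w, hw, fun _ => hne⟩
    · exact ⟨u 0, hu.1 0 ⟨le_rfl, hT.le⟩, fun h => absurd h hU⟩
  obtain ⟨z, x, X, θ, y, a, h⟩ := hS.exists_isExcursionSequence hW hT x₀ hu hv hw
  by_cases hb : S.U.Nontrivial ∧ Bornology.IsBounded (X '' Ico 0 T)
  · obtain ⟨ξ, hξ⟩ := h.exists_isBVlocSLimitSolutionIcc hS hT hv (hwne hb.1) hb.2
    refine ⟨Function.update X T ξ, h.isBVlocSLimitSolutionIco hS hT hv fun t ht => ?_,
      fun _ _ => hξ⟩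
    rw [Function.update_of_ne ht.2.ne]
  · exact ⟨X, h.isBVlocSLimitSolutionIco hS hT hv fun t _ => rfl, fun h1 h2 => absurd ⟨h1, h2⟩ hb⟩

end ImpulsiveSystem

/-! ### Approximation of controls alone, and conclusion -/

/-- The system with control set `U` whose state space is a point. -/
def trivialSystem {m : ℕ} (U : Set (EuclideanSpace ℝ (Fin m))) : ImpulsiveSystem 0 m 0 where
  U := U
  V := {0}
  g₀ := fun _ _ _ => 0
  g := fun _ _ _ => 0

theorem trivialSystem_standingAssumptions {m : ℕ} {U : Set (EuclideanSpace ℝ (Fin m))}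
    (hU : IsCompact U) : (trivialSystem U).StandingAssumptions where
  isCompact_U := hU
  isCompact_V := isCompact_singleton
  continuousOn_g₀ := continuousOn_const
  locallyLipschitz_g₀ := fun p _ => ⟨0, univ, univ_mem, fun _ _ =>
    (LipschitzWith.const _).lipschitzOnWith⟩
  locallyLipschitz_g := fun _ => (LipschitzWith.const _).locallyLipschitz.locallyLipschitzOn
  growth := ⟨1, one_pos, fun x w _ v _ => by
    simp only [trivialSystem, norm_zero]
    exact ⟨by positivity, fun _ => by positivity⟩⟩

theorem FinalTimeCondition.snd {m : ℕ} {F G : Type*} [NormedAddCommGroup F] [NormedAddCommGroup G]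
    {T : ℝ} {u : ℕ → ℝ → EuclideanSpace ℝ (Fin m)} {y : ℕ → ℝ → F} {z : ℕ → ℝ → G}
    (h : FinalTimeCondition T u fun k t => (y k t, z k t)) : FinalTimeCondition T u z := by
  obtain ⟨ε, s, κ, h1, h2, h3, h4, h5, h6, h7, h8, h9⟩ := h
  refine ⟨ε, s, κ, h1, h2, h3, h4, h5, h6, h7, h8, fun j k hk => ?_⟩
  obtain ⟨τ, hτ0, hτT, hτ, hle⟩ := h9 j k hk
  exact ⟨τ, hτ0, hτT, hτ, (norm_snd_le _).trans hle⟩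

/-- For a state space reduced to a point the trajectory is automatically bounded, and the second
component of the final-time condition is the statement about controls. -/
theorem exists_approximating_controls {m : ℕ} {U : Set (EuclideanSpace ℝ (Fin m))}
    (hU : IsCompact U) (hW : WhitneyProperty U) {T : ℝ} (hT : 0 < T)
    {u : ℝ → EuclideanSpace ℝ (Fin m)} (hu : IsBVlocControl U T u) :
    ∃ uk : ℕ → ℝ → EuclideanSpace ℝ (Fin m),
      (∀ k, IsACControl U T (uk k) ∧ uk k 0 = u 0) ∧
      (∀ t ∈ Icc 0 T, Tendsto (fun k => uk k t) atTop (𝓝 (u t))) ∧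
      LocallyEquiboundedVariation T uk ∧ (U.Nontrivial → FinalTimeCondition T uk uk) := by
  have hv : IsL1Control (trivialSystem U).V T 0 :=
    ⟨integrableOn_zero, Eventually.of_forall fun _ => rfl⟩
  obtain ⟨X, ⟨uk, xk, ⟨h1, h2, h3, _⟩, _⟩, hIcc⟩ :=
    (trivialSystem_standingAssumptions hU).exists_limitSolution hW hT 0 hu hv
  by_cases hne : U.Nontrivial
  · obtain ⟨_, uk, xk, ⟨h1, h2, h3, _⟩, _, _, hfin⟩ := hIcc hne
      ((Metric.isBounded_closedBall (x := (0 : EuclideanSpace ℝ (Fin 0))) (r := 0)).subset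
        fun y _ => by simp [Subsingleton.elim y 0])
    exact ⟨uk, h1, h2, h3, fun _ => hfin.snd⟩
  · exact ⟨uk, h1, h2, h3, fun h => absurd h hne⟩

theorem mainTheorem5 {n m l : ℕ} (S : ImpulsiveSystem n m l) (hS : S.StandingAssumptions)
    (hW : WhitneyProperty S.U) (T : ℝ) (hT : 0 < T) :
    (∀ (x₀ : EuclideanSpace ℝ (Fin n)) (u : ℝ → EuclideanSpace ℝ (Fin m))
        (v : ℝ → EuclideanSpace ℝ (Fin l)),
      IsBVlocControl S.U T u → IsL1Control S.V T v →
      ∃ x : ℝ → EuclideanSpace ℝ (Fin n),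
        S.IsBVlocSLimitSolutionIco T x₀ u v x ∧
        (S.U.Nontrivial → Bornology.IsBounded (x '' Ico 0 T) →
          S.IsBVlocSLimitSolutionIcc T x₀ u v x)) ∧
    (∀ u : ℝ → EuclideanSpace ℝ (Fin m), IsBVlocControl S.U T u →
      ∃ uk : ℕ → ℝ → EuclideanSpace ℝ (Fin m),
        (∀ k, IsACControl S.U T (uk k) ∧ uk k 0 = u 0) ∧
        (∀ t ∈ Icc 0 T, Tendsto (fun k => uk k t) atTop (𝓝 (u t))) ∧
        LocallyEquiboundedVariation T uk ∧
        (S.U.Nontrivial → FinalTimeCondition T uk uk)) := by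
  refine ⟨fun x₀ u v hu hv => ?_, fun u hu => ?_⟩
  · exact hS.exists_limitSolution hW hT x₀ hu hv
  · exact exists_approximating_controls hS.isCompact_U hW hT hu
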